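/- Let $d\ge 2$ be an integer and let $[d]_\star=\bigcup_{n\ge 0}[d]^n$ be the set of finite words over $[d]=\{1,\dots,d\}$, with $o$ the empty word and $u\cdot v$ denoting concatenation. For an integer $k\ge 1$ let $\mathbb{T}_{d,k}$ be the oriented graph with vertex set $[d]_\star$, with a short edge from $u$ to $u\cdot a$ for every vertex $u$ and every $a\in[d]$, and with a long edge from $u$ to $u\cdot r$ for every vertex $u$ and every $r\in[d]^k$ (for $k=1$, a short and a long edge with the same endpoints are regarded as two distinct parallel edges). For $p,q\in[0,1]$ let $\mathbb{P}_{p,q}$ be the law under which all edges are independent, each short edge being open with probability $p$ and each long edge being open with probability $q$. Let $o\leadsto\infty$ be the event that infinitely many vertices can be reached from $o$ by finite oriented paths of open edges, and define $$q_c(p,k)=\inf\{q\in[0,1] : \mathbb{P}_{p,q}(o\leadsto\infty)>0\}.$$ Theorem. For every $d\ge 2$, every $k\ge 1$ and every $p\in[0,1]$, if $q_c(p,k)>0$ then $q_c(p,k+1)<q_c(p,k)$. -/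

import Mathlib

open MeasureTheory ProbabilityTheory
open scoped unitInterval

namespace TreePercolation

/-- Vertices of the oriented rooted `d`-ary tree: finite words over an alphabet of `d` letters.
The root is the empty word `[]`, and `u ++ v` is the concatenation `u · v`. -/
abbrev Vertex (d : ℕ) : Type := List (Fin d)

/-- Short edges `⟨u, u · a⟩`, with `a` a letter, recorded by the pair `(u, a)`. -/
abbrev ShortEdge (d : ℕ) : Type := Vertex d × Fin d

/-- Long edges `⟨u, u · r⟩`, with `r` a word of length `k`, recorded by the pair `(u, r)`. -/
abbrev LongEdge (d k : ℕ) : Type := Vertex d × (Fin k → Fin d)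

/-- Percolation configurations: a state (`true` for open, `false` for closed) for every short edge
and one for every long edge. For `k = 1` a short and a long edge with the same endpoints are
two parallel edges, each with its own state. -/
abbrev Config (d k : ℕ) : Type := (ShortEdge d → Bool) × (LongEdge d k → Bool)

/-- The law under which all edges are independent, short edges are open with probability `p` and
long edges are open with probability `q`. -/
noncomputable def law (d k : ℕ) (p q : I) : Measure (Config d k) :=
  (Measure.infinitePi fun _ : ShortEdge d => bernoulliMeasure true false p).prod
    (Measure.infinitePi fun _ : LongEdge d k => bernoulliMeasure true false q)

/-- There is an open edge, short or long, from `u` to `v`. -/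
def OpenEdge {d k : ℕ} (ω : Config d k) (u v : Vertex d) : Prop :=
  (∃ a : Fin d, v = u ++ [a] ∧ ω.1 (u, a) = true) ∨
    (∃ r : Fin k → Fin d, v = u ++ List.ofFn r ∧ ω.2 (u, r) = true)

/-- `u ⇝ v`: there is a finite (possibly trivial) path of open edges from `u` to `v`. -/
def Reaches {d k : ℕ} (ω : Config d k) (u v : Vertex d) : Prop :=
  Relation.ReflTransGen (OpenEdge ω) u v

/-- The event `u ⇝ ∞`: infinitely many vertices can be reached from `u`. -/
def reachesInfinity (d k : ℕ) (u : Vertex d) : Set (Config d k) :=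
  {ω | {v : Vertex d | Reaches ω u v}.Infinite}

/-- The percolative region: the pairs `(p, q)` in `[0,1]²` for which infinitely many vertices can be
reached from the root with positive probability. -/
def percolativeRegion (d k : ℕ) : Set (I × I) :=
  {x | 0 < law d k x.1 x.2 (reachesInfinity d k [])}

/-- The critical value `q_c(p, k) = inf {q : (p, q) is in the percolative region}`, on the `d`-ary
tree. -/
noncomputable def qc (d : ℕ) (p : I) (k : ℕ) : ℝ :=
  sInf ((fun q : I => (q : ℝ)) '' {q : I | (p, q) ∈ percolativeRegion d k})

end TreePercolation

/-! All vertices at depth n are reached with the same probability a_n (`rayProb`), that of crossing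
a single ray. Percolation is read off d^n a_n: summability excludes it by Borel–Cantelli
(`law_reachesInfinity_eq_zero`), and d^n a_n > 1 for a single n forces it by a second-order
inclusion–exclusion bound (`law_reachesInfinity_pos`). It remains to compare rays for k and k + 1.

Let q = q_c(p,k), and sort the crossings of a ray of length n by the number j of long edges on the
path that, traced back from the endpoint, prefers short edges. Lengthening each of these edges by
one gives a crossing of a ray of length n + j for k + 1, so the probability b of crossing with j
skips is at most the (k + 1)-crossing probability at length n + j (`raySkipProb_le_rayProb`).

Suppose d^m times the (k + 1)-crossing probability at length m never exceeds 1 at this q. Then d^n b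
≤ d^(-j), an exponential gain when j is comparable to n. When j is small, almost every step is a
short edge, and pd < 1 (`mul_lt_one_of_qc_pos`) supplies the gain (`raySkipProb_mul_pow_le`).
Interpolation makes (dρ)^n a_n summable for some ρ > 1 (`exists_summable_of_rayProb_succ_le`).
Multiplying q by at most ρ costs at most ρ^n (`rayProb_le_pow_mul`), so there is no percolation just
above q_c(p,k), a contradiction. Hence the (k + 1)-rays are strictly supercritical at q, and by
continuity still so slightly below q. -/

namespace TreePercolation

/-! ### Percolation along a single ray -/

/-- The probability that an edge which is open with probability `p` is in a given state. -/
def edgeWeight (p : ℝ) (s : Bool) : ℝ := if s then p else 1 - p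

theorem edgeWeight_nonneg {p : ℝ} (hp : p ∈ Set.Icc (0 : ℝ) 1) (s : Bool) :
    0 ≤ edgeWeight p s := by
  unfold edgeWeight
  split_ifs <;> linarith [hp.1, hp.2]

theorem sum_edgeWeight (p : ℝ) : ∑ s, edgeWeight p s = 1 := by
  simp [edgeWeight]

theorem le_sum_edgeWeight_mul {p : ℝ} (hp : p ∈ Set.Icc (0 : ℝ) 1) {c : ℝ} {f : Bool → ℝ}
    (h : ∀ s, c ≤ f s) : c ≤ ∑ s, edgeWeight p s * f s := by
  calc c = ∑ s, edgeWeight p s * c := by rw [← Finset.sum_mul, sum_edgeWeight, one_mul]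
    _ ≤ _ := Finset.sum_le_sum fun s _ => mul_le_mul_of_nonneg_left (h s) (edgeWeight_nonneg hp s)

/-- The weight of the pair of states of the short and the long edge arriving at a site. -/
def bitWeight (p q : ℝ) (b : Bool × Bool) : ℝ := edgeWeight p b.1 * edgeWeight q b.2

theorem bitWeight_nonneg {p q : ℝ} (hp : p ∈ Set.Icc (0 : ℝ) 1)
    (hq : q ∈ Set.Icc (0 : ℝ) 1) (b : Bool × Bool) : 0 ≤ bitWeight p q b :=
  mul_nonneg (edgeWeight_nonneg hp _) (edgeWeight_nonneg hq _)

theorem sum_bitWeight_mul (p q : ℝ) (f : Bool × Bool → ℝ) :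
    ∑ b, bitWeight p q b * f b =
      ∑ s, edgeWeight p s * ∑ l, edgeWeight q l * f (s, l) := by
  simp only [Fintype.sum_prod_type, bitWeight, mul_assoc, Finset.mul_sum]

theorem sum_bitWeight (p q : ℝ) : ∑ b, bitWeight p q b = 1 := by
  rw [Fintype.sum_prod_type]
  simp only [bitWeight, ← Finset.mul_sum, sum_edgeWeight, mul_one]

/-- Averaging over the states of the two edges arriving at the next site of the ray. Histories list
the states of the edges arriving at the sites, the most recent first. -/
def rayStep (p q : ℝ) : (List (Bool × Bool) → ℝ) →ₗ[ℝ] (List (Bool × Bool) → ℝ) where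
  toFun f h := ∑ b, bitWeight p q b * f (b :: h)
  map_add' f g := by
    ext h
    simp [mul_add, Finset.sum_add_distrib]
  map_smul' c f := by
    ext h
    simp [Finset.mul_sum, mul_left_comm]

theorem rayStep_apply (p q : ℝ) (f : List (Bool × Bool) → ℝ) (h : List (Bool × Bool)) :
    rayStep p q f h = ∑ b, bitWeight p q b * f (b :: h) := rfl

theorem rayStep_pow_succ (p q : ℝ) (n : ℕ) (f : List (Bool × Bool) → ℝ)
    (h : List (Bool × Bool)) :
    (rayStep p q ^ (n + 1)) f h = ∑ b, bitWeight p q b * (rayStep p q ^ n) f (b :: h) := by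
  rw [pow_succ', Module.End.mul_apply, rayStep_apply]

theorem rayStep_pow_le {p q : ℝ} (hp : p ∈ Set.Icc (0 : ℝ) 1) (hq : q ∈ Set.Icc (0 : ℝ) 1)
    {f g : List (Bool × Bool) → ℝ} (n : ℕ) (h : List (Bool × Bool))
    (hfg : ∀ h', h'.length = n + h.length → f h' ≤ g h') :
    (rayStep p q ^ n) f h ≤ (rayStep p q ^ n) g h := by
  induction n generalizing h with
  | zero => simpa using hfg h (by simp)
  | succ n ih =>
    rw [rayStep_pow_succ, rayStep_pow_succ]
    refine Finset.sum_le_sum fun b _ => mul_le_mul_of_nonneg_left ?_ (bitWeight_nonneg hp hq b)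
    exact ih _ fun h' hh' => hfg h' (by rw [hh', List.length_cons]; omega)

theorem rayStep_pow_nonneg {p q : ℝ} (hp : p ∈ Set.Icc (0 : ℝ) 1) (hq : q ∈ Set.Icc (0 : ℝ) 1)
    {f : List (Bool × Bool) → ℝ} (hf : ∀ h, 0 ≤ f h) (n : ℕ) (h : List (Bool × Bool)) :
    0 ≤ (rayStep p q ^ n) f h := by
  have := rayStep_pow_le hp hq (f := 0) (g := f) n h fun h' _ => hf h'
  simpa using this

theorem rayStep_const (p q c : ℝ) : rayStep p q (fun _ => c) = fun _ => c := by
  ext h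
  rw [rayStep_apply, ← Finset.sum_mul, sum_bitWeight, one_mul]

theorem rayStep_pow_const (p q c : ℝ) (n : ℕ) : (rayStep p q ^ n) (fun _ => c) = fun _ => c := by
  induction n with
  | zero => rfl
  | succ n ih => rw [pow_succ, Module.End.mul_apply, rayStep_const, ih]

/-- The `j` most recent sites are ignored by the function, so their weights sum to one. -/
theorem rayStep_pow_drop (p q : ℝ) (f : List (Bool × Bool) → ℝ) (j : ℕ) :
    (rayStep p q ^ j) (fun h => f (h.drop j)) = f := by
  induction j with
  | zero => rfl
  | succ j ih =>
    rw [pow_succ, Module.End.mul_apply]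
    convert ih using 2
    ext h
    simp only [rayStep_apply, List.drop_succ_cons]
    rw [← Finset.sum_mul, sum_bitWeight, one_mul]

/-! ### Reached sites and the skip count -/

/-- Given the history of the edges along a ray, is the current site reached from the origin when
long edges have length `k`? -/
def RayReached (k : ℕ) : List (Bool × Bool) → Prop
  | [] => True
  | b :: h => (b.1 = true ∧ RayReached k h) ∨
      (b.2 = true ∧ k ≤ h.length + 1 ∧ RayReached k (h.drop (k - 1)))
termination_by h => h.length
decreasing_by all_goals simp; try omega

open Classical in
/-- The number of long edges on the path to the current site in which short edges are preferred,
if the current site is reached; in general, the number of sites which the ray for length `k + 1`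
is ahead in the comparison with the ray for length `k`. -/
noncomputable def skips (k : ℕ) : List (Bool × Bool) → ℕ
  | [] => 0
  | b :: h => if b.1 = true ∧ RayReached k h then skips k h
      else if k ≤ h.length + 1 ∧ RayReached k (h.drop (k - 1)) then skips k (h.drop (k - 1)) + 1
      else skips k h
termination_by h => h.length
decreasing_by all_goals simp; try omega

theorem rayReached_nil (k : ℕ) : RayReached k [] := by
  rw [RayReached]; trivial

theorem rayReached_cons {k : ℕ} {b : Bool × Bool} {h : List (Bool × Bool)} :
    RayReached k (b :: h) ↔ (b.1 = true ∧ RayReached k h) ∨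
      (b.2 = true ∧ k ≤ h.length + 1 ∧ RayReached k (h.drop (k - 1))) := by
  rw [RayReached]

theorem skips_nil (k : ℕ) : skips k [] = 0 := by
  rw [skips]

theorem skips_cons_short {k : ℕ} {b : Bool × Bool} {h : List (Bool × Bool)}
    (hb : b.1 = true ∧ RayReached k h) : skips k (b :: h) = skips k h := by
  rw [skips, if_pos hb]

theorem skips_cons_long {k : ℕ} {b : Bool × Bool} {h : List (Bool × Bool)}
    (hb : ¬(b.1 = true ∧ RayReached k h))
    (hk : k ≤ h.length + 1 ∧ RayReached k (h.drop (k - 1))) :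
    skips k (b :: h) = skips k (h.drop (k - 1)) + 1 := by
  rw [skips, if_neg hb, if_pos hk]

theorem skips_cons_neither {k : ℕ} {b : Bool × Bool} {h : List (Bool × Bool)}
    (hk : ¬(k ≤ h.length + 1 ∧ RayReached k (h.drop (k - 1)))) :
    skips k (b :: h) = skips k h := by
  rw [skips, if_neg hk, ite_self]

theorem skips_cons_cases (k : ℕ) (b : Bool × Bool) (h : List (Bool × Bool)) :
    skips k (b :: h) = skips k h ∨ skips k (b :: h) = skips k (h.drop (k - 1)) + 1 := by
  rw [skips]
  split_ifs <;> simp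

/-- The two bounds feed each other in the induction: monotonicity at a new site uses the first bound
for the shorter history, and the first bound there uses monotonicity near the origin of the long
edge. Together they let the count grow by at most one per site. -/
theorem skips_bounds (k : ℕ) (h : List (Bool × Bool)) :
    skips k h ≤ skips k (h.drop (k - 1)) + 1 ∧ skips k h.tail ≤ skips k h := by
  induction hn : h.length using Nat.strong_induction_on generalizing h with
  | _ n ih =>
    cases h with
    | nil => simp [skips_nil]
    | cons b h =>
      rw [List.length_cons] at hn
      have ih0 := ih h.length (by omega) h rfl
      have hcases := skips_cons_cases k b h
      refine ⟨?_, by rw [List.tail_cons]; omega⟩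
      obtain hk | ⟨j, hj⟩ : k - 1 = 0 ∨ ∃ j, k - 1 = j + 1 := by
        rcases Nat.eq_zero_or_eq_succ_pred (k - 1) with h0 | h0
        · exact Or.inl h0
        · exact Or.inr ⟨_, h0⟩
      · simp [hk]
      · have hmono := (ih (h.drop j).length (by rw [List.length_drop]; omega) (h.drop j) rfl).2
        rw [List.tail_drop] at hmono
        rw [hj] at ih0 hcases ⊢
        rw [List.drop_succ_cons]
        omega

theorem skips_le_skips_cons (k : ℕ) (b : Bool × Bool) (h : List (Bool × Bool)) :
    skips k h ≤ skips k (b :: h) :=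
  (skips_bounds k (b :: h)).2

theorem skips_drop_le (k j : ℕ) (h : List (Bool × Bool)) : skips k (h.drop j) ≤ skips k h := by
  induction j with
  | zero => simp
  | succ j ih =>
    rw [← List.tail_drop]
    exact (skips_bounds k (h.drop j)).2.trans ih

theorem skips_le_length (k : ℕ) (h : List (Bool × Bool)) : skips k h ≤ h.length := by
  induction hn : h.length using Nat.strong_induction_on generalizing h with
  | _ n ih =>
    cases h with
    | nil => simp [skips_nil]
    | cons b h =>
      rw [List.length_cons] at hn
      have h1 := ih h.length (by omega) h rfl
      have h2 := skips_drop_le k (k - 1) h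
      have h3 := skips_cons_cases k b h
      omega

open Classical in
/-- The probability that a ray of length `n` is crossed. -/
noncomputable def rayProb (k : ℕ) (p q : ℝ) (n : ℕ) : ℝ :=
  (rayStep p q ^ n) (fun h => if RayReached k h then 1 else 0) []

open Classical in
/-- The probability that a ray of length `n` is crossed with exactly `j` skips. -/
noncomputable def raySkipProb (k : ℕ) (p q : ℝ) (n j : ℕ) : ℝ :=
  (rayStep p q ^ n) (fun h => if RayReached k h ∧ skips k h = j then 1 else 0) []

/-! ### Coupling of the rays for `k` and `k + 1` -/

/-- A history `h'` for long edges of length `k + 1` dominates a history `h` for length `k`: the site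
corresponding to each reached site is reached. -/
def Dominates (k : ℕ) (h h' : List (Bool × Bool)) : Prop :=
  h'.length = h.length + skips k h ∧ ∀ j ≤ h.length, RayReached k (h.drop j) →
    RayReached (k + 1) (h'.drop (j + (skips k h - skips k (h.drop j))))

theorem Dominates.reached {k : ℕ} {h h' : List (Bool × Bool)} (hd : Dominates k h h')
    (hr : RayReached k h) : RayReached (k + 1) h' := by
  have := hd.2 0 (Nat.zero_le _) (by simpa using hr)
  simpa using this

/-- No new skip is created when the next sites of the two rays correspond to each other. -/
theorem Dominates.cons_of_skips_eq {k : ℕ} {h h' : List (Bool × Bool)} (hd : Dominates k h h')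
    {b b' : Bool × Bool} (hs : skips k (b :: h) = skips k h)
    (hr : RayReached k (b :: h) → RayReached (k + 1) (b' :: h')) :
    Dominates k (b :: h) (b' :: h') := by
  refine ⟨by rw [hs, List.length_cons, List.length_cons, hd.1]; omega, fun j hj hrj => ?_⟩
  cases j with
  | zero => simpa using hr hrj
  | succ j =>
    rw [List.drop_succ_cons] at hrj ⊢
    rw [hs, add_right_comm, List.drop_succ_cons]
    exact hd.2 j (by simpa using hj) hrj

theorem Dominates.cons_cons {k : ℕ} {h h' : List (Bool × Bool)} (hd : Dominates k h h')
    {b b' b'' : Bool × Bool} (hs : skips k (b :: h) = skips k h + 1)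
    (hr : RayReached k (b :: h) → RayReached (k + 1) (b'' :: b' :: h')) :
    Dominates k (b :: h) (b'' :: b' :: h') := by
  refine ⟨by rw [hs, List.length_cons, List.length_cons, List.length_cons, hd.1]; omega,
    fun j hj hrj => ?_⟩
  cases j with
  | zero => simpa using hr hrj
  | succ j =>
    have hle := skips_drop_le k j h
    rw [List.drop_succ_cons] at hrj ⊢
    rw [hs, show j + 1 + (skips k h + 1 - skips k (h.drop j)) =
      (j + (skips k h - skips k (h.drop j))) + 1 + 1 by omega, List.drop_succ_cons,
      List.drop_succ_cons]
    exact hd.2 j (by simpa using hj) hrj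

open Classical in
theorem rayStep_pow_skips_of_lt {k : ℕ} (p q : ℝ) (n N : ℕ) (h : List (Bool × Bool))
    (hN : N < skips k h) :
    (rayStep p q ^ n) (fun h => if RayReached k h ∧ skips k h = N then 1 else 0) h = 0 := by
  induction n generalizing h with
  | zero => simpa using fun _ => hN.ne'
  | succ n ih =>
    rw [rayStep_pow_succ]
    refine Finset.sum_eq_zero fun b _ => ?_
    rw [ih _ (hN.trans_le (skips_le_skips_cons k b h)), mul_zero]

-- The two rays are explored together, with a site of the first matched to the site of the second
-- shifted by its skip count. This works because `skips` never consults the long edge arriving at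
-- the new site: once the short state is revealed, it is known whether the second ray must insert an
-- extra site, and the long state can still be shared afterwards.
open Classical in
theorem rayStep_pow_skips_le {k : ℕ} (hk : 1 ≤ k) {p q : ℝ} (hp : p ∈ Set.Icc (0 : ℝ) 1)
    (hq : q ∈ Set.Icc (0 : ℝ) 1) (n N : ℕ) (h h' : List (Bool × Bool)) (hd : Dominates k h h')
    (hN : skips k h ≤ N) :
    (rayStep p q ^ n) (fun h => if RayReached k h ∧ skips k h = N then 1 else 0) h ≤
      (rayStep p q ^ (n + (N - skips k h)))
        (fun h => if RayReached (k + 1) h then 1 else 0) h' := by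
  induction n generalizing h h' with
  | zero =>
    by_cases hc : RayReached k h ∧ skips k h = N
    · obtain ⟨hr, rfl⟩ := hc
      simp [hr, hd.reached hr]
    · simp only [pow_zero, Module.End.one_apply, if_neg hc]
      exact rayStep_pow_nonneg hp hq (fun h => by positivity) _ _
  | succ n ih =>
    rw [add_right_comm, rayStep_pow_succ, rayStep_pow_succ]
    -- Only in this case can the count increase: no extra site has been inserted since the origin of
    -- the long edge, so an edge of length `k + 1` from the matching origin needs one more site.
    by_cases hB : (k ≤ h.length + 1 ∧ RayReached k (h.drop (k - 1))) ∧
        skips k (h.drop (k - 1)) = skips k h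
    · obtain ⟨hB1, hB2⟩ := hB
      have hlong : RayReached (k + 1) (h'.drop (k - 1)) := by
        have := hd.2 (k - 1) (by omega) hB1.2
        rwa [hB2, Nat.sub_self, Nat.add_zero] at this
      rw [sum_bitWeight_mul, sum_bitWeight_mul]
      refine Finset.sum_le_sum fun s _ => mul_le_mul_of_nonneg_left ?_ (edgeWeight_nonneg hp _)
      by_cases hs : s = true ∧ RayReached k h
      · refine Finset.sum_le_sum fun l _ => mul_le_mul_of_nonneg_left ?_ (edgeWeight_nonneg hq _)
        have hsk : skips k ((s, l) :: h) = skips k h := skips_cons_short hs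
        have := ih ((s, l) :: h) ((s, l) :: h') (hd.cons_of_skips_eq hsk fun _ =>
          rayReached_cons.2 (Or.inl ⟨hs.1, hd.reached hs.2⟩)) (by omega)
        rwa [hsk] at this
      · have hsk (l : Bool) : skips k ((s, l) :: h) = skips k h + 1 := by
          rw [skips_cons_long hs hB1, hB2]
        -- The second ray takes two sites: one with the shared short state `s` and a fresh long
        -- state `l'`, then one with a fresh short state `s'` and the shared long state `l`. The
        -- bound holds for every value of the fresh states, hence on average.
        have hpt (l' : Bool) : ∑ l : Bool, edgeWeight q l * (rayStep p q ^ n)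
            (fun h => if RayReached k h ∧ skips k h = N then 1 else 0) ((s, l) :: h) ≤
            (rayStep p q ^ (n + (N - skips k h)))
              (fun h => if RayReached (k + 1) h then 1 else 0) ((s, l') :: h') := by
          -- If the count already equals `N`, the new skip overshoots and the left side vanishes.
          rcases hN.eq_or_lt with hN | hN
          · rw [Finset.sum_eq_zero fun l _ => by
              rw [rayStep_pow_skips_of_lt p q n N _ (by rw [hsk]; omega), mul_zero]]
            exact rayStep_pow_nonneg hp hq (fun h => by positivity) _ _
          · rw [show n + (N - skips k h) = n + (N - (skips k h + 1)) + 1 by omega,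
              rayStep_pow_succ, sum_bitWeight_mul]
            refine le_sum_edgeWeight_mul hp fun s' => ?_
            refine Finset.sum_le_sum fun l _ => mul_le_mul_of_nonneg_left ?_ (edgeWeight_nonneg hq _)
            have hdom : Dominates k ((s, l) :: h) ((s', l) :: (s, l') :: h') := by
              refine hd.cons_cons (hsk l) fun hr => rayReached_cons.2 (Or.inr ?_)
              rcases rayReached_cons.1 hr with hr | hr
              · exact absurd hr hs
              · refine ⟨hr.1, by rw [List.length_cons, hd.1]; omega, ?_⟩
                rw [show k + 1 - 1 = (k - 1) + 1 by omega, List.drop_succ_cons]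
                exact hlong
            have := ih _ _ hdom (by rw [hsk]; omega)
            rwa [hsk] at this
        exact le_sum_edgeWeight_mul hq hpt
    -- Exactly one extra site already lies between a reached origin and the current site, so the
    -- lengths `k` and `k + 1` match and both rays can use the same pair `b`.
    · have hA (hA1 : k ≤ h.length + 1 ∧ RayReached k (h.drop (k - 1))) :
          skips k h = skips k (h.drop (k - 1)) + 1 := by
        have h1 := (skips_bounds k h).1
        have h2 := skips_drop_le k (k - 1) h
        have h3 : skips k (h.drop (k - 1)) ≠ skips k h := fun h3 => hB ⟨hA1, h3⟩
        omega
      refine Finset.sum_le_sum fun b _ => mul_le_mul_of_nonneg_left ?_ (bitWeight_nonneg hp hq b)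
      have hsk : skips k (b :: h) = skips k h := by
        by_cases hs : b.1 = true ∧ RayReached k h
        · exact skips_cons_short hs
        · by_cases hA1 : k ≤ h.length + 1 ∧ RayReached k (h.drop (k - 1))
          · rw [skips_cons_long hs hA1, hA hA1]
          · exact skips_cons_neither hA1
      have hdom : Dominates k (b :: h) (b :: h') := by
        refine hd.cons_of_skips_eq hsk fun hr => rayReached_cons.2 ?_
        rcases rayReached_cons.1 hr with ⟨hb, hr⟩ | ⟨hb, hr⟩
        · exact Or.inl ⟨hb, hd.reached hr⟩
        · have hA2 := hA hr
          have := hd.2 (k - 1) (by omega) hr.2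
          rw [show k - 1 + (skips k h - skips k (h.drop (k - 1))) = k + 1 - 1 by omega] at this
          exact Or.inr ⟨hb, by rw [hd.1]; omega, this⟩
      have := ih _ _ hdom (by omega)
      rwa [hsk] at this

theorem raySkipProb_le_rayProb {k : ℕ} (hk : 1 ≤ k) {p q : ℝ} (hp : p ∈ Set.Icc (0 : ℝ) 1)
    (hq : q ∈ Set.Icc (0 : ℝ) 1) (n j : ℕ) :
    raySkipProb k p q n j ≤ rayProb (k + 1) p q (n + j) := by
  have hd : Dominates k [] [] :=
    ⟨by simp [skips_nil], fun j _ _ => by simpa using rayReached_nil _⟩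
  have := rayStep_pow_skips_le hk hp hq n j [] [] hd (by simp [skips_nil])
  rwa [skips_nil, Nat.sub_zero] at this

theorem raySkipProb_nonneg (k : ℕ) {p q : ℝ} (hp : p ∈ Set.Icc (0 : ℝ) 1)
    (hq : q ∈ Set.Icc (0 : ℝ) 1) (n j : ℕ) : 0 ≤ raySkipProb k p q n j :=
  rayStep_pow_nonneg hp hq (fun h => by positivity) _ _

theorem rayProb_nonneg (k : ℕ) {p q : ℝ} (hp : p ∈ Set.Icc (0 : ℝ) 1)
    (hq : q ∈ Set.Icc (0 : ℝ) 1) (n : ℕ) : 0 ≤ rayProb k p q n :=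
  rayStep_pow_nonneg hp hq (fun h => by positivity) _ _

theorem rayProb_le_sum_raySkipProb (k : ℕ) {p q : ℝ} (hp : p ∈ Set.Icc (0 : ℝ) 1)
    (hq : q ∈ Set.Icc (0 : ℝ) 1) (n : ℕ) :
    rayProb k p q n ≤ ∑ j ∈ Finset.range (n + 1), raySkipProb k p q n j := by
  classical
  unfold raySkipProb
  rw [← Finset.sum_apply, ← map_sum]
  refine rayStep_pow_le hp hq n [] fun h hh => ?_
  rw [Finset.sum_apply]
  split_ifs with hr
  · refine le_of_eq_of_le ?_ (Finset.single_le_sum (fun i _ => by positivity)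
      (Finset.mem_range.2 (Nat.lt_succ_of_le (skips_le_length k h |>.trans (by simp [hh])))))
    simp [hr]
  · exact Finset.sum_nonneg fun i _ => by positivity

/-! ### Recursive bounds for crossings with few skips -/

open Classical in
theorem rayStep_skips_le {k : ℕ} {p q : ℝ} (hp : p ∈ Set.Icc (0 : ℝ) 1)
    (hq : q ∈ Set.Icc (0 : ℝ) 1) (j : ℕ) (h : List (Bool × Bool)) :
    rayStep p q (fun h => if RayReached k h ∧ skips k h = j then 1 else 0) h ≤
      p * (if RayReached k h ∧ skips k h = j then 1 else 0) +
      q * (if k ≤ h.length + 1 ∧ RayReached k (h.drop (k - 1)) ∧ skips k (h.drop (k - 1)) + 1 = j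
        then 1 else 0) := by
  set x : ℝ := if RayReached k h ∧ skips k h = j then 1 else 0 with hx
  set y : ℝ := if k ≤ h.length + 1 ∧ RayReached k (h.drop (k - 1)) ∧
    skips k (h.drop (k - 1)) + 1 = j then 1 else 0 with hy
  have hx0 : 0 ≤ x := by positivity
  have hy0 : 0 ≤ y := by positivity
  calc _ ≤ ∑ b : Bool × Bool, bitWeight p q b *
        ((if b.1 then x else 0) + (if b.2 then y else 0)) := by
        rw [rayStep_apply]
        refine Finset.sum_le_sum fun b _ => mul_le_mul_of_nonneg_left ?_ (bitWeight_nonneg hp hq b)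
        have hx1 : 0 ≤ if b.1 then x else 0 := by positivity
        have hy1 : 0 ≤ if b.2 then y else 0 := by positivity
        by_cases hc : RayReached k (b :: h) ∧ skips k (b :: h) = j
        · rw [if_pos hc]
          obtain ⟨hr, hs⟩ := hc
          by_cases hb : b.1 = true ∧ RayReached k h
          · rw [skips_cons_short hb] at hs
            have hx2 : x = 1 := if_pos ⟨hb.2, hs⟩
            rw [if_pos hb.1]
            linarith
          · obtain hr | hr := rayReached_cons.1 hr
            · exact absurd hr hb
            · rw [skips_cons_long hb hr.2] at hs
              have hy2 : y = 1 := if_pos ⟨hr.2.1, hr.2.2, hs⟩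
              rw [if_pos hr.1]
              linarith
        · rw [if_neg hc]
          linarith
    _ = p * x + q * y := by
        rw [Fintype.sum_prod_type]
        simp [bitWeight, edgeWeight]
        ring

/-- The last step of the preferred path is either short or long. The disjunction avoids truncated
subtraction: a long last step is possible only when `k - 1 ≤ n` and `1 ≤ j`. -/
theorem raySkipProb_succ_le {k : ℕ} {p q : ℝ} (hp : p ∈ Set.Icc (0 : ℝ) 1)
    (hq : q ∈ Set.Icc (0 : ℝ) 1) (n j : ℕ) :
    raySkipProb k p q (n + 1) j ≤ p * raySkipProb k p q n j ∨
      ∃ m i, n = m + (k - 1) ∧ j = i + 1 ∧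
        raySkipProb k p q (n + 1) j ≤ p * raySkipProb k p q n j + q * raySkipProb k p q m i := by
  classical
  by_cases hc : k - 1 ≤ n ∧ 1 ≤ j
  · right
    obtain ⟨m, rfl⟩ := Nat.exists_eq_add_of_le' hc.1
    obtain ⟨i, rfl⟩ := Nat.exists_eq_add_of_le' hc.2
    refine ⟨m, i, rfl, rfl, ?_⟩
    set f : List (Bool × Bool) → ℝ :=
      fun h => if RayReached k h ∧ skips k h = i + 1 then 1 else 0 with hf
    set g : List (Bool × Bool) → ℝ := fun h => if RayReached k h ∧ skips k h = i then 1 else 0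
      with hg
    have key : (rayStep p q ^ (m + (k - 1))) (rayStep p q f) [] ≤
        (rayStep p q ^ (m + (k - 1))) (p • f + q • fun h => g (h.drop (k - 1))) [] := by
      refine rayStep_pow_le hp hq _ _ fun h hh => (rayStep_skips_le hp hq (i + 1) h).trans_eq ?_
      have : k ≤ h.length + 1 := by rw [hh]; simp; omega
      simp [hf, hg, this]
    rw [map_add, map_smul, map_smul, pow_add _ m, Module.End.mul_apply, Module.End.mul_apply,
      Module.End.mul_apply, rayStep_pow_drop] at key
    unfold raySkipProb
    rw [pow_succ, pow_add, Module.End.mul_apply, Module.End.mul_apply]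
    exact key
  · left
    set f : List (Bool × Bool) → ℝ :=
      fun h => if RayReached k h ∧ skips k h = j then 1 else 0 with hf
    have key : (rayStep p q ^ n) (rayStep p q f) [] ≤ (rayStep p q ^ n) (p • f) [] := by
      refine rayStep_pow_le hp hq _ _ fun h hh => (rayStep_skips_le hp hq j h).trans_eq ?_
      have : ¬(k ≤ h.length + 1 ∧ RayReached k (h.drop (k - 1)) ∧
          skips k (h.drop (k - 1)) + 1 = j) := by
        rw [hh]; simp only [List.length_nil]; omega
      simp [hf, this]
    rw [map_smul] at key
    unfold raySkipProb
    rw [pow_succ, Module.End.mul_apply]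
    exact key

/-- The condition `hzK` says precisely that `K ^ j / z ^ n`, for `z > 0`, is a supersolution of the
recursion. -/
theorem raySkipProb_mul_pow_le {k : ℕ} (hk : 1 ≤ k) {p q z K : ℝ} (hp : p ∈ Set.Icc (0 : ℝ) 1)
    (hq : q ∈ Set.Icc (0 : ℝ) 1) (hz : 0 ≤ z) (hK : 0 < K) (hzK : p * z * K + q * z ^ k ≤ K)
    (n j : ℕ) : raySkipProb k p q n j * z ^ n ≤ K ^ j := by
  classical
  induction n using Nat.strong_induction_on generalizing j with
  | _ n ih =>
    cases n with
    | zero =>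
      have : raySkipProb k p q 0 j = if j = 0 then 1 else 0 := by
        simp [raySkipProb, rayReached_nil, skips_nil, eq_comm]
      rw [this]
      split_ifs with hj
      · simp [hj]
      · simpa using pow_nonneg hK.le j
    | succ n =>
      have h1 := ih n (by omega) j
      have hpz : 0 ≤ p * z := mul_nonneg hp.1 hz
      have hqz : 0 ≤ q * z ^ k := mul_nonneg hq.1 (pow_nonneg hz k)
      rcases raySkipProb_succ_le (k := k) hp hq n j with h | ⟨m, i, rfl, rfl, h⟩
      -- Since `K > 0` and `q * z ^ k ≥ 0`, `hzK` forces `p * z ≤ 1`.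
      · have hpz1 : p * z * K ^ j ≤ K ^ j := by
          refine mul_le_of_le_one_left (pow_nonneg hK.le j) ?_
          by_contra! hcon
          nlinarith
        calc raySkipProb k p q (n + 1) j * z ^ (n + 1)
            ≤ p * raySkipProb k p q n j * z ^ (n + 1) :=
              mul_le_mul_of_nonneg_right h (pow_nonneg hz _)
          _ = p * z * (raySkipProb k p q n j * z ^ n) := by ring
          _ ≤ p * z * K ^ j := mul_le_mul_of_nonneg_left h1 hpz
          _ ≤ K ^ j := hpz1
      · have h2 := ih m (by omega) i
        calc raySkipProb k p q (m + (k - 1) + 1) (i + 1) * z ^ (m + (k - 1) + 1)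
            ≤ (p * raySkipProb k p q (m + (k - 1)) (i + 1) + q * raySkipProb k p q m i) *
                z ^ (m + (k - 1) + 1) := mul_le_mul_of_nonneg_right h (pow_nonneg hz _)
          _ = p * z * (raySkipProb k p q (m + (k - 1)) (i + 1) * z ^ (m + (k - 1))) +
              q * z ^ (k - 1 + 1) * (raySkipProb k p q m i * z ^ m) := by ring
          _ ≤ p * z * K ^ (i + 1) + q * z ^ k * K ^ i := by
              rw [Nat.sub_add_cancel hk]
              gcongr
          _ = (p * z * K + q * z ^ k) * K ^ i := by ring
          _ ≤ K ^ (i + 1) := by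
              rw [pow_succ' K]
              gcongr

/-- Each long edge costs a factor at most `q' / q`: exactly this ratio if open, and at most 1 if
closed. No monotonicity of `f` is needed. -/
theorem rayStep_pow_le_pow_mul {p q q' : ℝ} (hp : p ∈ Set.Icc (0 : ℝ) 1) (hq : 0 < q)
    (hqq : q ≤ q') (hq' : q' ≤ 1) {f : List (Bool × Bool) → ℝ} (hf : ∀ h, 0 ≤ f h) (n : ℕ)
    (h : List (Bool × Bool)) :
    (rayStep p q' ^ n) f h ≤ (q' / q) ^ n * (rayStep p q ^ n) f h := by
  have hqI : q ∈ Set.Icc (0 : ℝ) 1 := ⟨hq.le, hqq.trans hq'⟩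
  have hqI' : q' ∈ Set.Icc (0 : ℝ) 1 := ⟨hq.le.trans hqq, hq'⟩
  have hw (s : Bool) : edgeWeight q' s ≤ q' / q * edgeWeight q s := by
    have h1 : 1 ≤ q' / q := (one_le_div hq).2 hqq
    cases s
    · simp only [edgeWeight]
      have := le_mul_of_one_le_left (sub_nonneg.2 hqI.2) h1
      simp only [Bool.false_eq_true, if_false]
      linarith
    · simp only [edgeWeight, if_true]
      rw [div_mul_cancel₀ _ hq.ne']
  induction n generalizing h with
  | zero => simp
  | succ n ih =>
    rw [rayStep_pow_succ, rayStep_pow_succ, Finset.mul_sum]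
    refine Finset.sum_le_sum fun b _ => ?_
    calc bitWeight p q' b * (rayStep p q' ^ n) f (b :: h)
        ≤ (edgeWeight p b.1 * (q' / q * edgeWeight q b.2)) *
          ((q' / q) ^ n * (rayStep p q ^ n) f (b :: h)) := by
          refine mul_le_mul (mul_le_mul_of_nonneg_left (hw _) (edgeWeight_nonneg hp _)) (ih _)
            (rayStep_pow_nonneg hp hqI' hf _ _) (mul_nonneg (edgeWeight_nonneg hp _) ?_)
          exact mul_nonneg (div_nonneg hqI'.1 hq.le) (edgeWeight_nonneg hqI _)
      _ = _ := by rw [bitWeight]; ring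

theorem rayProb_le_pow_mul (k : ℕ) {p q q' : ℝ} (hp : p ∈ Set.Icc (0 : ℝ) 1) (hq : 0 < q)
    (hqq : q ≤ q') (hq' : q' ≤ 1) (n : ℕ) :
    rayProb k p q' n ≤ (q' / q) ^ n * rayProb k p q n :=
  rayStep_pow_le_pow_mul hp hq hqq hq' (fun h => by positivity) n []

theorem pow_le_rayProb (k : ℕ) {p q : ℝ} (hp : p ∈ Set.Icc (0 : ℝ) 1)
    (hq : q ∈ Set.Icc (0 : ℝ) 1) (n : ℕ) : p ^ n ≤ rayProb k p q n := by
  classical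
  suffices H : ∀ h, RayReached k h →
      p ^ n ≤ (rayStep p q ^ n) (fun h => if RayReached k h then 1 else 0) h from
    H [] (rayReached_nil k)
  induction n with
  | zero => intro h hr; simp [hr]
  | succ n ih =>
    intro h hr
    rw [rayStep_pow_succ, sum_bitWeight_mul, Fintype.sum_bool, pow_succ']
    have h1 : p * p ^ n ≤ edgeWeight p true * ∑ l, edgeWeight q l *
        (rayStep p q ^ n) (fun h => if RayReached k h then 1 else 0) ((true, l) :: h) := by
      rw [edgeWeight, if_pos rfl]
      refine mul_le_mul_of_nonneg_left (le_sum_edgeWeight_mul hq fun l => ih _ ?_) hp.1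
      exact rayReached_cons.2 (Or.inl ⟨rfl, hr⟩)
    have h2 : 0 ≤ edgeWeight p false * ∑ l, edgeWeight q l *
        (rayStep p q ^ n) (fun h => if RayReached k h then 1 else 0) ((false, l) :: h) :=
      mul_nonneg (edgeWeight_nonneg hp _) (Finset.sum_nonneg fun l _ => mul_nonneg
        (edgeWeight_nonneg hq _) (rayStep_pow_nonneg hp hq (fun h => by positivity) _ _))
    linarith

/-- The last long edge joins the origin directly to site `k`; it is independent of the event that
all `k` short edges are open, and the bound is the probability of the union. -/
theorem le_rayProb_self {k : ℕ} (hk : 1 ≤ k) {p q : ℝ} (hp : p ∈ Set.Icc (0 : ℝ) 1)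
    (hq : q ∈ Set.Icc (0 : ℝ) 1) : p ^ k + q * (1 - p ^ k) ≤ rayProb k p q k := by
  classical
  obtain ⟨j, rfl⟩ := Nat.exists_eq_add_of_le' hk
  set f : List (Bool × Bool) → ℝ := fun h => if RayReached (j + 1) h then 1 else 0 with hf
  have key : (rayStep p q ^ j) (((1 - q) * p) • f + fun _ => q) [] ≤
      (rayStep p q ^ j) (rayStep p q f) [] := by
    refine rayStep_pow_le hp hq j [] fun h hh => ?_
    have h0 : h.drop j = [] := List.drop_eq_nil_of_le (by simp [hh])
    have hlong (s : Bool) : f ((s, true) :: h) = 1 := by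
      rw [hf]
      refine if_pos (rayReached_cons.2 (Or.inr ⟨rfl, by simp [hh], ?_⟩))
      simpa [h0] using rayReached_nil _
    have hshort : f h ≤ f ((true, false) :: h) := by
      by_cases hr : RayReached (j + 1) h
      · simp [hf, hr, rayReached_cons]
      · simp only [hf, if_neg hr]; positivity
    have hnn : 0 ≤ f ((false, false) :: h) := by simp only [hf]; positivity
    rw [rayStep_apply, Fintype.sum_prod_type]
    simp only [Fintype.sum_bool, bitWeight, edgeWeight, hlong, Pi.add_apply, Pi.smul_apply,
      smul_eq_mul, if_true, Bool.false_eq_true, if_false]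
    have := mul_le_mul_of_nonneg_left hshort (mul_nonneg (sub_nonneg.2 hq.2) hp.1)
    have := mul_nonneg (mul_nonneg (sub_nonneg.2 hp.2) (sub_nonneg.2 hq.2)) hnn
    nlinarith
  rw [map_add, map_smul, rayStep_pow_const] at key
  have h1 : p ^ j ≤ (rayStep p q ^ j) f [] := pow_le_rayProb (j + 1) hp hq j
  have h2 : (rayStep p q ^ j) (rayStep p q f) [] = rayProb (j + 1) p q (j + 1) := by
    rw [rayProb, pow_succ, Module.End.mul_apply]
  rw [h2] at key
  simp only [Pi.add_apply, Pi.smul_apply, smul_eq_mul] at key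
  have := mul_le_mul_of_nonneg_left h1 (mul_nonneg (sub_nonneg.2 hq.2) hp.1)
  rw [pow_succ]
  linarith

/-- If the rays with long edges of length `k + 1` are not supercritical, then the probability of
crossing rays with long edges of length `k` decays faster than `c⁻ⁿ`. -/
theorem exists_summable_of_rayProb_succ_le {k : ℕ} (hk : 1 ≤ k) {p q c : ℝ}
    (hp : p ∈ Set.Icc (0 : ℝ) 1) (hq : q ∈ Set.Icc (0 : ℝ) 1) (hq0 : 0 < q) (hc : 1 < c)
    (hpc : p * c < 1) (hbound : ∀ n, c ^ n * rayProb (k + 1) p q n ≤ 1) :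
    ∃ ρ > 1, Summable fun n => (c * ρ) ^ n * rayProb k p q n := by
  have hc0 : 0 < c := by linarith
  obtain ⟨z, hcz, hz⟩ : ∃ z, c < z ∧ p * z < 1 := by
    have hcont : Filter.Tendsto (fun z => p * z) (nhdsWithin c (Set.Ioi c)) (nhds (p * c)) :=
      ((continuous_const.mul continuous_id).tendsto c).mono_left nhdsWithin_le_nhds
    obtain ⟨z, hz1, hz2⟩ := ((hcont.eventually (gt_mem_nhds hpc)).and
      self_mem_nhdsWithin).exists
    exact ⟨z, hz2, hz1⟩
  have hz0 : 0 < z := hc0.trans hcz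
  -- This value gives equality in `p * z * K + q * z ^ k ≤ K`.
  set K : ℝ := q * z ^ k / (1 - p * z) with hKdef
  have hK : 0 < K := div_pos (by positivity) (by linarith)
  have hzK : p * z * K + q * z ^ k ≤ K := by
    have : K * (1 - p * z) = q * z ^ k := div_mul_cancel₀ _ (by linarith : 1 - p * z ≠ 0)
    linarith
  obtain ⟨N, hN⟩ := pow_unbounded_of_one_lt K hc
  set r : ℝ := (c / z) ^ ((↑(N + 1) : ℝ)⁻¹) with hr
  have hcz1 : c / z < 1 := (div_lt_one hz0).2 hcz
  have hr0 : 0 < r := Real.rpow_pos_of_pos (by positivity) _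
  have hr1 : r < 1 := Real.rpow_lt_one (by positivity) hcz1 (by positivity)
  have hrN : r ^ (N + 1) = c / z := Real.rpow_inv_natCast_pow (by positivity) (by omega)
  have hb (n j : ℕ) : c ^ n * raySkipProb k p q n j ≤ r ^ n := by
    set b := raySkipProb k p q n j with hbdef
    have hb0 : 0 ≤ b := raySkipProb_nonneg k hp hq n j
    have h1 : b * z ^ n ≤ K ^ j := raySkipProb_mul_pow_le hk hp hq hz0.le hK hzK n j
    have h2 : c ^ (n + j) * b ≤ 1 :=
      (mul_le_mul_of_nonneg_left (raySkipProb_le_rayProb hk hp hq n j) (by positivity)).trans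
        (hbound _)
    -- Interpolation: multiply `N` copies of `h2` by one copy of `h1`. The `N` factors `c ^ j`
    -- absorb `K ^ j` because `K < c ^ N`, leaving `(c / z) ^ n`, uniformly in `j`.
    refine le_of_pow_le_pow_left₀ (n := N + 1) (by omega) (by positivity) ?_
    rw [← pow_mul, mul_comm n, pow_mul, hrN, div_pow, le_div_iff₀ (by positivity)]
    have h3 : (c ^ j) ^ N * ((c ^ n * b) ^ (N + 1) * z ^ n) =
        c ^ n * (c ^ (n + j) * b) ^ N * (b * z ^ n) := by ring
    have h4 : (c ^ n * (c ^ (n + j) * b) ^ N) * (b * z ^ n) ≤ (c ^ n * 1) * K ^ j := by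
      gcongr
      exact pow_le_one₀ (by positivity) h2
    have h5 : K ^ j ≤ (c ^ j) ^ N := by
      rw [← pow_mul, mul_comm j, pow_mul]
      gcongr
    have h6 : (c ^ j) ^ N * ((c ^ n * b) ^ (N + 1) * z ^ n) ≤ (c ^ j) ^ N * c ^ n := by
      rw [h3]
      refine h4.trans ?_
      rw [mul_one, mul_comm]
      gcongr
    exact le_of_mul_le_mul_left h6 (by positivity)
  -- Any value strictly between 1 and `1 / r` would do; the slack also absorbs the `n + 1` possible
  -- values of `j`.
  set ρ : ℝ := 2 / (1 + r) with hρ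
  have hρ0 : 0 < ρ := by positivity
  refine ⟨ρ, (one_lt_div (by positivity)).2 (by linarith), ?_⟩
  have hrρ : r * ρ < 1 := by
    rw [hρ, mul_div_assoc', div_lt_one (by positivity)]
    linarith
  have hsum : Summable fun n : ℕ => (n + 1 : ℝ) * (r * ρ) ^ n := by
    have h1 := summable_pow_mul_geometric_of_norm_lt_one 1
      (r := r * ρ) (by rwa [Real.norm_of_nonneg (by positivity)])
    have h2 := summable_geometric_of_lt_one (by positivity) hrρ
    simpa [add_mul] using h1.add h2
  refine Summable.of_nonneg_of_le (fun n => mul_nonneg (by positivity) (rayProb_nonneg k hp hq n))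
    (fun n => ?_) hsum
  calc (c * ρ) ^ n * rayProb k p q n
      ≤ (c * ρ) ^ n * ∑ j ∈ Finset.range (n + 1), raySkipProb k p q n j :=
        mul_le_mul_of_nonneg_left (rayProb_le_sum_raySkipProb k hp hq n) (by positivity)
    _ = ρ ^ n * ∑ j ∈ Finset.range (n + 1), c ^ n * raySkipProb k p q n j := by
        rw [mul_pow, ← Finset.mul_sum]; ring
    _ ≤ ρ ^ n * ∑ j ∈ Finset.range (n + 1), r ^ n := by
        gcongr with j _
        exact hb n j
    _ = (n + 1 : ℝ) * (r * ρ) ^ n := by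
        rw [Finset.sum_const, Finset.card_range, nsmul_eq_mul, mul_pow]; push_cast; ring

/-! ### The edges of the tree -/

/-- The edges of the graph, short and long. -/
abbrev Edge (d k : ℕ) : Type := ShortEdge d ⊕ LongEdge d k

/-- The vertex from which an edge leaves. -/
def Edge.source {d k : ℕ} : Edge d k → Vertex d
  | Sum.inl e => e.1
  | Sum.inr e => e.1

/-- The vertex at which an edge arrives. -/
def Edge.target {d k : ℕ} : Edge d k → Vertex d
  | Sum.inl e => e.1 ++ [e.2]
  | Sum.inr e => e.1 ++ List.ofFn e.2

/-- The state of an edge. -/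
def edgeState {d k : ℕ} : Edge d k → Config d k → Bool
  | Sum.inl e, ω => ω.1 e
  | Sum.inr e, ω => ω.2 e

/-- The probability that an edge is open. -/
def edgeProb {d k : ℕ} (p q : I) : Edge d k → I
  | Sum.inl _ => p
  | Sum.inr _ => q

/-- The events which only depend on the states of the edges in `A`. -/
abbrev edgeSigma {d k : ℕ} (A : Set (Edge d k)) : MeasurableSpace (Config d k) :=
  ⨆ e ∈ A, MeasurableSpace.comap (edgeState e) ⊤

instance (d k : ℕ) (p q : I) : IsProbabilityMeasure (law d k p q) := by
  unfold law
  infer_instance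

theorem source_prefix_target {d k : ℕ} (e : Edge d k) : e.source <+: e.target := by
  cases e <;> exact List.prefix_append _ _

theorem length_source_lt {d k : ℕ} (hk : 1 ≤ k) (e : Edge d k) :
    e.source.length < e.target.length := by
  cases e <;> simp [Edge.source, Edge.target]; omega

theorem openEdge_iff {d k : ℕ} {ω : Config d k} {u v : Vertex d} :
    OpenEdge ω u v ↔ ∃ e : Edge d k, e.source = u ∧ e.target = v ∧ edgeState e ω = true := by
  constructor
  · rintro (⟨a, rfl, h⟩ | ⟨r, rfl, h⟩)
    · exact ⟨Sum.inl (u, a), rfl, rfl, h⟩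
    · exact ⟨Sum.inr (u, r), rfl, rfl, h⟩
  · rintro ⟨⟨u, a⟩ | ⟨u, r⟩, rfl, rfl, h⟩
    · exact Or.inl ⟨a, rfl, h⟩
    · exact Or.inr ⟨r, rfl, h⟩

theorem measurable_edgeState {d k : ℕ} (e : Edge d k) : Measurable (edgeState e) := by
  cases e with
  | inl e => exact (measurable_pi_apply e).comp measurable_fst
  | inr e => exact (measurable_pi_apply e).comp measurable_snd

theorem edgeSigma_le {d k : ℕ} (A : Set (Edge d k)) : edgeSigma A ≤ (inferInstance : MeasurableSpace (Config d k)) :=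
  iSup₂_le fun e _ => (measurable_edgeState e).comap_le

theorem measurableSet_edgeState {d k : ℕ} {A : Set (Edge d k)} {e : Edge d k} (he : e ∈ A)
    (s : Bool) : MeasurableSet[edgeSigma A] {ω | edgeState e ω = s} := by
  have h : MeasurableSpace.comap (edgeState e) ⊤ ≤ edgeSigma A :=
    le_iSup₂_of_le (f := fun e (_ : e ∈ A) => MeasurableSpace.comap (edgeState e) ⊤) e he le_rfl
  exact h _ ⟨{s}, trivial, rfl⟩

theorem law_edgeState {d k : ℕ} (p q : I) (e : Edge d k) (s : Bool) :
    law d k p q {ω | edgeState e ω = s} =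
      ENNReal.ofReal (edgeWeight (edgeProb p q e : I) s) := by
  have hb (x : I) : bernoulliMeasure true false x {s} = ENNReal.ofReal (edgeWeight x s) := by
    have h1 : unitInterval.toNNReal x = Real.toNNReal x := by
      rw [← unitInterval.coe_toNNReal x, Real.toNNReal_coe]
    have h2 : unitInterval.toNNReal (unitInterval.symm x) = Real.toNNReal (1 - x) := by
      rw [← unitInterval.coe_symm_eq, ← unitInterval.coe_toNNReal (unitInterval.symm x),
        Real.toNNReal_coe]
    rw [bernoulliMeasure_apply x (by simp)]
    cases s <;> simp [edgeWeight, ENNReal.ofReal, h1, h2]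
  cases e with
  | inl e =>
    have : {ω : Config d k | edgeState (Sum.inl e) ω = s} =
        ((fun x : ShortEdge d → Bool => x e) ⁻¹' {s}) ×ˢ Set.univ := by
      ext ω; simp [edgeState]
    rw [this, law, Measure.prod_prod, measure_univ, mul_one,
      (measurePreserving_eval_infinitePi _ e).measure_preimage (by simp), hb]
    rfl
  | inr e =>
    have : {ω : Config d k | edgeState (Sum.inr e) ω = s} =
        Set.univ ×ˢ ((fun x : LongEdge d k → Bool => x e) ⁻¹' {s}) := by
      ext ω; simp [edgeState]
    rw [this, law, Measure.prod_prod, measure_univ, one_mul,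
      (measurePreserving_eval_infinitePi _ e).measure_preimage (by simp), hb]
    rfl

theorem iIndepFun_edgeState (d k : ℕ) (p q : I) :
    iIndepFun (fun e : Edge d k => edgeState e) (law d k p q) := by
  classical
  rw [iIndepFun_iff_measure_inter_preimage_eq_mul]
  intro S t _
  obtain ⟨A, B, rfl⟩ : ∃ A B, S = Finset.disjSum A B := ⟨_, _, (Finset.toLeft_disjSum_toRight).symm⟩
  have h1 (e : ShortEdge d) : law d k p q (edgeState (Sum.inl e) ⁻¹' t (Sum.inl e)) =
      bernoulliMeasure true false p (t (Sum.inl e)) := by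
    have : edgeState (Sum.inl e) ⁻¹' t (Sum.inl e) =
        ((fun x : ShortEdge d → Bool => x e) ⁻¹' t (Sum.inl e)) ×ˢ
          (Set.univ : Set (LongEdge d k → Bool)) := by
      ext ω; simp [edgeState]
    rw [this, law, Measure.prod_prod, measure_univ, mul_one,
      (measurePreserving_eval_infinitePi _ e).measure_preimage (by simp)]
  have h2 (e : LongEdge d k) : law d k p q (edgeState (Sum.inr e) ⁻¹' t (Sum.inr e)) =
      bernoulliMeasure true false q (t (Sum.inr e)) := by
    have : edgeState (Sum.inr e) ⁻¹' t (Sum.inr e) = (Set.univ : Set (ShortEdge d → Bool)) ×ˢ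
        ((fun x : LongEdge d k → Bool => x e) ⁻¹' t (Sum.inr e)) := by
      ext ω; simp [edgeState]
    rw [this, law, Measure.prod_prod, measure_univ, one_mul,
      (measurePreserving_eval_infinitePi _ e).measure_preimage (by simp)]
  have h3 : ⋂ i ∈ A.disjSum B, edgeState i ⁻¹' t i =
      (Set.pi A fun e => t (Sum.inl e)) ×ˢ (Set.pi B fun e => t (Sum.inr e)) := by
    ext ω
    simp [edgeState, Set.mem_pi]
  rw [Finset.prod_disjSum, Finset.prod_congr rfl fun e _ => h1 e,
    Finset.prod_congr rfl fun e _ => h2 e, h3, law, Measure.prod_prod, Measure.infinitePi_pi _ (by simp),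
    Measure.infinitePi_pi _ (by simp)]

theorem indep_edgeSigma {d k : ℕ} (p q : I) {A B : Set (Edge d k)} (h : Disjoint A B) :
    Indep (edgeSigma A) (edgeSigma B) (law d k p q) :=
  indep_iSup_of_disjoint (fun e => (measurable_edgeState e).comap_le)
    (iIndepFun_edgeState d k p q).iIndep h

theorem law_inter {d k : ℕ} (p q : I) {A B : Set (Edge d k)} (h : Disjoint A B)
    {s t : Set (Config d k)} (hs : MeasurableSet[edgeSigma A] s)
    (ht : MeasurableSet[edgeSigma B] t) :
    law d k p q (s ∩ t) = law d k p q s * law d k p q t :=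
  (Indep_iff _ _ _).1 (indep_edgeSigma p q h) s t hs ht

/-! ### Locality of connection events -/

theorem Reaches.prefix {d k : ℕ} {ω : Config d k} {u v : Vertex d} (h : Reaches ω u v) :
    u <+: v := by
  induction h with
  | refl => exact List.prefix_rfl
  | tail _ h ih =>
    obtain ⟨e, rfl, rfl, -⟩ := openEdge_iff.1 h
    exact ih.trans (source_prefix_target e)

theorem reaches_iff {d k : ℕ} {ω : Config d k} {u v : Vertex d} :
    Reaches ω u v ↔ v = u ∨ ∃ e : Edge d k, e.target = v ∧ edgeState e ω = true ∧
      Reaches ω u e.source := by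
  rw [Reaches, Relation.ReflTransGen.cases_tail_iff]
  refine or_congr Iff.rfl ⟨?_, ?_⟩
  · rintro ⟨w, h, hw⟩
    obtain ⟨e, rfl, rfl, he⟩ := openEdge_iff.1 hw
    exact ⟨e, rfl, he, h⟩
  · rintro ⟨e, rfl, he, h⟩
    exact ⟨_, h, openEdge_iff.2 ⟨e, rfl, rfl, he⟩⟩

/-- Decomposing by the last edge shows that only edges between `u` and `v` matter; this is the
source of the independence statements about connections. -/
theorem measurableSet_reaches {d k : ℕ} (hk : 1 ≤ k) {A : Set (Edge d k)} (u v : Vertex d)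
    (hA : ∀ e : Edge d k, u <+: e.source → e.target <+: v → e ∈ A) :
    MeasurableSet[edgeSigma A] {ω | Reaches ω u v} := by
  induction hn : v.length using Nat.strong_induction_on generalizing v with
  | _ n ih =>
    have : {ω : Config d k | Reaches ω u v} = {_ω | v = u} ∪ ⋃ e : Edge d k, ⋃ _ : e.target = v,
        {ω | edgeState e ω = true} ∩ {ω | Reaches ω u e.source} := by
      ext ω
      simp only [Set.mem_union, Set.mem_iUnion, Set.mem_inter_iff, Set.mem_ofPred_eq, exists_prop]
      exact reaches_iff
    rw [this]
    refine MeasurableSet.union (MeasurableSet.const _) (MeasurableSet.iUnion fun e =>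
      MeasurableSet.iUnion fun he => ?_)
    by_cases hu : u <+: e.source
    · refine (measurableSet_edgeState (hA e hu (he ▸ List.prefix_rfl)) true).inter
        (ih e.source.length ?_ e.source (fun e' h1 h2 => hA e' h1 ?_) rfl)
      · rw [← hn, ← he]
        exact length_source_lt hk e
      · exact h2.trans ((source_prefix_target e).trans (he ▸ List.prefix_rfl))
    · have : {ω : Config d k | Reaches ω u e.source} = ∅ :=
        Set.eq_empty_of_forall_notMem fun ω h => hu (Reaches.prefix h)
      rw [this, Set.inter_empty]
      exact @MeasurableSet.empty _ (edgeSigma A)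

/-! ### Translations of the tree -/

/-- The configuration seen from the vertex `u`. -/
def shift {d k : ℕ} (u : Vertex d) (ω : Config d k) : Config d k :=
  (fun e => ω.1 (u ++ e.1, e.2), fun e => ω.2 (u ++ e.1, e.2))

theorem measurePreserving_shift {d k : ℕ} (p q : I) (u : Vertex d) :
    MeasurePreserving (shift u) (law d k p q) (law d k p q) := by
  have h1 : Function.Injective fun e : ShortEdge d => ((u ++ e.1, e.2) : ShortEdge d) := by
    rintro ⟨x, a⟩ ⟨y, b⟩ h
    simpa using h
  have h2 : Function.Injective fun e : LongEdge d k => ((u ++ e.1, e.2) : LongEdge d k) := by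
    rintro ⟨x, a⟩ ⟨y, b⟩ h
    simpa using h
  exact MeasurePreserving.prod
    ⟨by fun_prop, Measure.map_infinitePi_infinitePi_of_inj h1⟩
    ⟨by fun_prop, Measure.map_infinitePi_infinitePi_of_inj h2⟩

theorem openEdge_shift {d k : ℕ} {u x y : Vertex d} {ω : Config d k} :
    OpenEdge (shift u ω) x y ↔ OpenEdge ω (u ++ x) (u ++ y) := by
  simp [OpenEdge, shift, List.append_assoc]

theorem reaches_shift {d k : ℕ} {u x y : Vertex d} {ω : Config d k} :
    Reaches (shift u ω) x y ↔ Reaches ω (u ++ x) (u ++ y) := by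
  constructor
  · exact fun h => Relation.ReflTransGen.lift (fun z => u ++ z) (fun _ _ => openEdge_shift.1) _ _ h
  · intro h
    suffices H : ∀ z, Reaches ω (u ++ x) z → ∀ y, z = u ++ y → Reaches (shift u ω) x y from
      H _ h y rfl
    intro z hz
    induction hz with
    | refl =>
      intro y hy
      rw [List.append_cancel_left hy]
      exact Relation.ReflTransGen.refl
    | @tail b c hb hbc ih =>
      rintro y rfl
      obtain ⟨w, rfl⟩ := (List.prefix_append u x).trans (Reaches.prefix hb)
      exact (ih w rfl).tail (openEdge_shift.2 hbc)

/-! ### Rays of the tree -/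

/-- The short edge arriving at the vertex with reversed word `a :: Y`. -/
def shortInto {d : ℕ} (k : ℕ) (Y : List (Fin d)) (a : Fin d) : Edge d k :=
  Sum.inl (Y.reverse, a)

/-- The long edge arriving at the vertex with reversed word `a :: Y`. -/
def longInto {d : ℕ} (k : ℕ) (Y : List (Fin d)) (a : Fin d) : Edge d k :=
  Sum.inr (((a :: Y).drop k).reverse, fun i => (a :: Y).getD (k - 1 - i) a)

theorem target_shortInto {d : ℕ} (k : ℕ) (Y : List (Fin d)) (a : Fin d) :
    (shortInto k Y a).target = (a :: Y).reverse := by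
  simp [shortInto, Edge.target]

/-- Under `hY` every index `k - 1 - i` is valid, so the default value of `getD` is never used. -/
theorem target_longInto {d k : ℕ} {Y : List (Fin d)} (hY : k ≤ Y.length + 1) (a : Fin d) :
    (longInto k Y a).target = (a :: Y).reverse := by
  have h : List.ofFn (fun i : Fin k => (a :: Y).getD (k - 1 - i) a) =
      ((a :: Y).take k).reverse := by
    have hlen : ((a :: Y).take k).length = k := by simp; omega
    apply List.ext_getElem
    · simp; omega
    · intro i h1 h2
      rw [List.length_ofFn] at h1
      rw [List.getElem_ofFn, List.getElem_reverse, List.getElem_take]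
      rw [List.getD_eq_getElem _ _ (by simp; omega)]
      congr 1
      simp only [hlen]
  rw [longInto, Edge.target, h, ← List.reverse_append, List.take_append_drop]

/-- An edge arriving at the vertex with reversed word `a :: Y` is the short or the long one. -/
theorem eq_of_target_eq {d k : ℕ} {e : Edge d k} {Y : List (Fin d)} {a : Fin d}
    (hY : k ≤ Y.length + 1) (he : e.target = (a :: Y).reverse) :
    e = shortInto k Y a ∨ e = longInto k Y a := by
  rcases e with ⟨x, b⟩ | ⟨x, r⟩
  · left
    have h : x ++ [b] = Y.reverse ++ [a] := by simpa [Edge.target] using he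
    obtain ⟨rfl, h2⟩ := List.append_inj' h rfl
    simp only [List.cons.injEq, and_true] at h2
    rw [h2, shortInto]
  · right
    have h := (target_longInto hY a).symm
    rw [← he] at h
    simp only [longInto, Edge.target] at h ⊢
    obtain ⟨h1, h2⟩ := List.append_inj' h (by simp)
    rw [h1, List.ofFn_injective h2]

/-- The states of the edges arriving at the vertices of the path from the vertex with reversed word
`U` to the vertex with reversed word `V ++ U`. -/
def rayHistory {d k : ℕ} (ω : Config d k) (U : List (Fin d)) : List (Fin d) → List (Bool × Bool)
  | [] => []
  | a :: V => (edgeState (shortInto k (V ++ U) a) ω, edgeState (longInto k (V ++ U) a) ω) ::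
      rayHistory ω U V

theorem length_rayHistory {d k : ℕ} (ω : Config d k) (U V : List (Fin d)) :
    (rayHistory ω U V).length = V.length := by
  induction V with
  | nil => rfl
  | cons a V ih => rw [rayHistory, List.length_cons, List.length_cons, ih]

theorem drop_rayHistory {d k : ℕ} (ω : Config d k) (U V : List (Fin d)) (j : ℕ) :
    (rayHistory ω U V).drop j = rayHistory ω U (V.drop j) := by
  induction j generalizing V with
  | zero => rfl
  | succ j ih =>
    cases V with
    | nil => rfl
    | cons a V => rw [rayHistory, List.drop_succ_cons, List.drop_succ_cons, ih]

/-- By `hU` the base vertex has depth at least `k - 1`, so a genuine long edge arrives at each later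
vertex of the ray. Those starting strictly above the base are useless, which is what the length
guard in `RayReached` encodes. -/
theorem reaches_iff_rayReached {d k : ℕ} (hk : 1 ≤ k) {ω : Config d k} {U : List (Fin d)}
    (hU : k ≤ U.length + 1) (V : List (Fin d)) :
    Reaches ω U.reverse (V ++ U).reverse ↔ RayReached k (rayHistory ω U V) := by
  induction hn : V.length using Nat.strong_induction_on generalizing V with
  | _ n ih =>
    cases V with
    | nil =>
      simp only [List.nil_append, rayHistory, rayReached_nil, iff_true]
      exact Relation.ReflTransGen.refl
    | cons a V =>
      have hY : k ≤ (V ++ U).length + 1 := by rw [List.length_append]; omega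
      have hlt : V.length < n := by rw [← hn, List.length_cons]; omega
      rw [rayHistory, rayReached_cons, length_rayHistory, drop_rayHistory, ← ih _ hlt V rfl,
        ← ih _ (by rw [List.length_drop]; omega) (V.drop (k - 1)) rfl, reaches_iff]
      have hlong : (longInto k (V ++ U) a).source = ((V ++ U).drop (k - 1)).reverse := by
        obtain ⟨j, rfl⟩ := Nat.exists_eq_add_of_le' hk
        simp [longInto, Edge.source]
      constructor
      · rintro (h | ⟨e, he, hes, hr⟩)
        · have := congrArg List.length h
          simp at this
        · rcases eq_of_target_eq hY (by simpa using he) with rfl | rfl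
          · exact Or.inl ⟨hes, hr⟩
          · rw [hlong] at hr
            have hle := (Reaches.prefix hr).length_le
            simp only [List.length_reverse, List.length_drop, List.length_append] at hle
            have hkV : k ≤ V.length + 1 := by omega
            refine Or.inr ⟨hes, hkV, ?_⟩
            rwa [List.drop_append_of_le_length (by omega)] at hr
      · rintro (⟨h1, h2⟩ | ⟨h1, h2, h3⟩)
        · exact Or.inr ⟨_, target_shortInto _ _ _, h1, h2⟩
        · refine Or.inr ⟨_, target_longInto hY _, h1, ?_⟩
          rwa [hlong, List.drop_append_of_le_length (by omega)]

theorem measurableSet_rayHistory {d k : ℕ} (U V : List (Fin d))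
    (hU : k ≤ U.length + 1) (h : List (Bool × Bool)) :
    MeasurableSet[edgeSigma {e : Edge d k | e.target.length ≤ V.length + U.length}]
      {ω | rayHistory ω U V = h} := by
  set A : ℕ → Set (Edge d k) := fun n => {e | e.target.length ≤ n} with hA
  have hmono {m n : ℕ} (hmn : m ≤ n) : edgeSigma (A m) ≤ edgeSigma (A n) :=
    iSup₂_mono' fun e he => ⟨e, le_trans he hmn, le_rfl⟩
  change MeasurableSet[edgeSigma (A _)] _
  induction V generalizing h with
  | nil =>
    simp only [rayHistory]
    exact @MeasurableSet.const _ (edgeSigma _) _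
  | cons a V ih =>
    cases h with
    | nil => simp [rayHistory]
    | cons b h =>
      have : {ω : Config d k | rayHistory ω U (a :: V) = b :: h} =
          ({ω | edgeState (shortInto k (V ++ U) a) ω = b.1} ∩
            {ω | edgeState (longInto k (V ++ U) a) ω = b.2}) ∩ {ω | rayHistory ω U V = h} := by
        ext ω
        simp [rayHistory, Prod.ext_iff]
      rw [this]
      refine MeasurableSet.inter (MeasurableSet.inter (measurableSet_edgeState ?_ _)
        (measurableSet_edgeState ?_ _)) (hmono (by simp) _ (ih h))
      · simp only [hA, Set.mem_ofPred_eq, target_shortInto]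
        simp; omega
      · simp only [hA, Set.mem_ofPred_eq]
        rw [target_longInto (by simp; omega)]
        simp; omega

theorem lintegral_mul_indicator {d k : ℕ} (p q : I) {A B : Set (Edge d k)} (h : Disjoint A B)
    {g : Config d k → ENNReal} {T : Set (Config d k)} (hg : Measurable[edgeSigma A] g)
    (hT : MeasurableSet[edgeSigma B] T) :
    ∫⁻ ω, g ω * T.indicator (fun _ => 1) ω ∂law d k p q =
      law d k p q T * ∫⁻ ω, g ω ∂law d k p q := by
  rw [lintegral_mul_indicator_eq_lintegral_mul_lintegral_indicator (edgeSigma_le A) 1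
    (edgeSigma_le _ _ hT) ?_ hg, lintegral_indicator (edgeSigma_le _ _ hT), setLIntegral_one,
    mul_comm]
  refine indepSets_of_indepSets_of_le_right
    ((Indep_iff_IndepSets _ _ _).1 (indep_edgeSigma p q h)) ?_
  rw [Set.singleton_subset_iff]
  exact hT

theorem law_edgeState_inter {d k : ℕ} (p q : I) {e e' : Edge d k} (he : e ≠ e') (s s' : Bool) :
    law d k p q ({ω | edgeState e ω = s} ∩ {ω | edgeState e' ω = s'}) =
      ENNReal.ofReal (edgeWeight (edgeProb p q e : I) s * edgeWeight (edgeProb p q e' : I) s') := by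
  rw [law_inter p q (A := {e}) (B := {e'}) (Set.disjoint_singleton.2 he)
    (measurableSet_edgeState (Set.mem_singleton e) _)
    (measurableSet_edgeState (Set.mem_singleton e') _), law_edgeState,
    law_edgeState, ENNReal.ofReal_mul (edgeWeight_nonneg (edgeProb p q e).2 _)]

theorem measurable_comp_rayHistory {d k : ℕ} {U : List (Fin d)} (hU : k ≤ U.length + 1)
    (V : List (Fin d)) (g : List (Bool × Bool) → ENNReal) :
    Measurable[edgeSigma {e : Edge d k | e.target.length ≤ V.length + U.length}]
      fun ω : Config d k => g (rayHistory ω U V) := by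
  intro s _
  have : (fun ω : Config d k => g (rayHistory ω U V)) ⁻¹' s =
      ⋃ h ∈ g ⁻¹' s, {ω | rayHistory ω U V = h} := by
    ext ω
    simp
  rw [this]
  exact MeasurableSet.biUnion (Set.to_countable _) fun h _ => measurableSet_rayHistory U V hU h

/-- The two edges arriving at the deepest vertex are independent of all edges arriving at smaller
depth, so integrating them out replaces `f` by `rayStep p q f`. -/
theorem lintegral_rayHistory {d k : ℕ} (p q : I) {U : List (Fin d)}
    (hU : k ≤ U.length + 1) (V : List (Fin d)) {f : List (Bool × Bool) → ℝ} (hf : ∀ h, 0 ≤ f h) :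
    ∫⁻ ω, ENNReal.ofReal (f (rayHistory ω U V)) ∂law d k p q =
      ENNReal.ofReal ((rayStep p q ^ V.length) f []) := by
  induction V generalizing f with
  | nil => simp [rayHistory]
  | cons a V ih =>
    have hp : (p : ℝ) ∈ Set.Icc (0 : ℝ) 1 := p.2
    have hq : (q : ℝ) ∈ Set.Icc (0 : ℝ) 1 := q.2
    set A : Set (Edge d k) := {e | e.target.length ≤ V.length + U.length} with hA
    set es : Edge d k := shortInto k (V ++ U) a with hes
    set el : Edge d k := longInto k (V ++ U) a with hel
    have hdisj : Disjoint A {es, el} := by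
      rw [Set.disjoint_right]
      rintro e (rfl | rfl)
      · simp [hA, hes, target_shortInto]
        omega
      · simp only [hA, Set.mem_ofPred_eq]
        rw [hel, target_longInto (by simp; omega)]
        simp
        omega
    have hne : es ≠ el := by simp [hes, hel, shortInto, longInto]
    set T : Bool × Bool → Set (Config d k) := fun b =>
      {ω | edgeState es ω = b.1} ∩ {ω | edgeState el ω = b.2} with hT
    have hTm (b : Bool × Bool) : MeasurableSet[edgeSigma {es, el}] (T b) :=
      MeasurableSet.inter (measurableSet_edgeState (by simp) _)
        (measurableSet_edgeState (by simp) _)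
    have hTlaw (b : Bool × Bool) : law d k p q (T b) = ENNReal.ofReal (bitWeight p q b) :=
      law_edgeState_inter p q hne b.1 b.2
    have hmeas (b : Bool × Bool) : Measurable[edgeSigma A] fun ω : Config d k =>
        ENNReal.ofReal (f (b :: rayHistory ω U V)) :=
      measurable_comp_rayHistory hU V fun h => ENNReal.ofReal (f (b :: h))
    have hmeas' (b : Bool × Bool) : Measurable fun ω : Config d k =>
        ENNReal.ofReal (f (b :: rayHistory ω U V)) := (hmeas b).mono (edgeSigma_le A) le_rfl
    have hpt (ω : Config d k) : ENNReal.ofReal (f (rayHistory ω U (a :: V))) =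
        ∑ b, ENNReal.ofReal (f (b :: rayHistory ω U V)) * (T b).indicator (fun _ => 1) ω := by
      rw [Finset.sum_eq_single (edgeState es ω, edgeState el ω)]
      · rw [Set.indicator_of_mem (by simp [hT]), mul_one]
        rfl
      · intro b _ hb
        rw [Set.indicator_of_notMem, mul_zero]
        rintro ⟨h1, h2⟩
        exact hb (Prod.ext h1.symm h2.symm)
      · simp
    simp_rw [hpt]
    calc ∫⁻ ω, ∑ b, ENNReal.ofReal (f (b :: rayHistory ω U V)) *
          (T b).indicator (fun _ => 1) ω ∂law d k p q
        = ∑ b, ∫⁻ ω, ENNReal.ofReal (f (b :: rayHistory ω U V)) *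
            (T b).indicator (fun _ => 1) ω ∂law d k p q :=
          lintegral_finsetSum _ fun b _ => (hmeas' b).mul
            (measurable_const.indicator (edgeSigma_le _ _ (hTm b)))
      _ = ∑ b, ENNReal.ofReal (bitWeight p q b) *
            ∫⁻ ω, ENNReal.ofReal (f (b :: rayHistory ω U V)) ∂law d k p q :=
          Finset.sum_congr rfl fun b _ => by
            rw [lintegral_mul_indicator p q hdisj (hmeas b) (hTm b), hTlaw]
      _ = ∑ b, ∫⁻ ω, ENNReal.ofReal (bitWeight p q b) *
            ENNReal.ofReal (f (b :: rayHistory ω U V)) ∂law d k p q :=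
          Finset.sum_congr rfl fun b _ => (lintegral_const_mul _ (hmeas' b)).symm
      _ = ∫⁻ ω, ∑ b, ENNReal.ofReal (bitWeight p q b) *
            ENNReal.ofReal (f (b :: rayHistory ω U V)) ∂law d k p q :=
          (lintegral_finsetSum _ fun b _ => (hmeas' b).const_mul _).symm
      _ = ∫⁻ ω, ENNReal.ofReal (rayStep p q f (rayHistory ω U V)) ∂law d k p q := by
          refine lintegral_congr fun ω => ?_
          rw [rayStep_apply, ENNReal.ofReal_sum_of_nonneg fun b _ =>
            mul_nonneg (bitWeight_nonneg hp hq b) (hf _)]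
          exact Finset.sum_congr rfl fun b _ =>
            (ENNReal.ofReal_mul (bitWeight_nonneg hp hq b)).symm
      _ = _ := by
          rw [ih (f := rayStep p q f) fun h => rayStep_pow_nonneg hp hq hf 1 h, List.length_cons, pow_succ,
            Module.End.mul_apply]

theorem law_reaches {d k : ℕ} (hd : 1 ≤ d) (hk : 1 ≤ k) (p q : I) (v : Vertex d) :
    law d k p q {ω | Reaches ω [] v} = ENNReal.ofReal (rayProb k p q v.length) := by
  classical
  -- Translation to depth `k - 1` creates the missing long edges into the first `k - 1` sites of the
  -- ray; they do not affect the event.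
  set U : List (Fin d) := List.replicate (k - 1) ⟨0, hd⟩ with hU
  have hUlen : k ≤ U.length + 1 := by rw [hU, List.length_replicate]; omega
  have h1 : law d k p q {ω | Reaches ω [] v} =
      law d k p q {ω | Reaches ω U.reverse (v.reverse ++ U).reverse} := by
    have hm : MeasurableSet {ω : Config d k | Reaches ω [] v} :=
      edgeSigma_le Set.univ _ (measurableSet_reaches hk [] v fun _ _ _ => trivial)
    rw [← (measurePreserving_shift p q U.reverse).measure_preimage hm.nullMeasurableSet]
    congr 1
    ext ω
    have := reaches_shift (u := U.reverse) (x := []) (y := v) (ω := ω)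
    simpa using this
  have h2 : MeasurableSet {ω : Config d k | Reaches ω U.reverse (v.reverse ++ U).reverse} :=
    edgeSigma_le Set.univ _ (measurableSet_reaches hk _ _ fun _ _ _ => trivial)
  have h3 := lintegral_rayHistory p q hUlen v.reverse
    (f := fun h => if RayReached k h then 1 else 0) fun h => by positivity
  rw [List.length_reverse] at h3
  rw [h1, rayProb, ← h3, ← lintegral_indicator_one h2]
  refine lintegral_congr fun ω => ?_
  simp only [Set.indicator_apply, Set.mem_ofPred_eq, reaches_iff_rayReached hk hUlen]
  split_ifs <;> simp

/-! ### Criteria for percolation -/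

theorem law_reachesInfinity_eq_zero {d k : ℕ} (hd : 1 ≤ d) (hk : 1 ≤ k) {p q : I}
    (hsum : Summable fun n => (d : ℝ) ^ n * rayProb k p q n) :
    law d k p q (reachesInfinity d k []) = 0 := by
  set L : ℕ → Set (Config d k) :=
    fun n => ⋃ v : Fin n → Fin d, {ω | Reaches ω [] (List.ofFn v)} with hL
  have hLn (n : ℕ) : law d k p q (L n) ≤ ENNReal.ofReal ((d : ℝ) ^ n * rayProb k p q n) := by
    refine (measure_iUnion_le _).trans ?_
    rw [tsum_fintype]
    simp only [law_reaches hd hk, List.length_ofFn, Finset.sum_const, Finset.card_univ,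
      Fintype.card_fun, Fintype.card_fin, nsmul_eq_mul]
    rw [ENNReal.ofReal_mul (by positivity), ENNReal.ofReal_pow (by positivity),
      ENNReal.ofReal_natCast]
    push_cast
    exact le_rfl
  have htsum : ∑' n, law d k p q (L n) ≠ ⊤ :=
    ne_top_of_le_ne_top hsum.tsum_ofReal_ne_top (ENNReal.tsum_le_tsum hLn)
  refine measure_mono_null ?_ (ae_iff.1 (ae_finite_setOfPred_mem htsum))
  intro ω hω hfin
  refine hω ((hfin.biUnion fun n _ => Set.finite_range (List.ofFn (n := n))).subset ?_)
  intro v hv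
  refine Set.mem_biUnion (x := v.length) ?_ ⟨v.get, List.ofFn_get v⟩
  have hv' : Reaches ω [] (List.ofFn v.get) := by rwa [List.ofFn_get]
  exact Set.mem_iUnion.2 ⟨v.get, hv'⟩

/-- Some vertex at distance at least `m` from `u` can be reached from `u`. -/
def reachesDepth (d k m : ℕ) (u : Vertex d) : Set (Config d k) :=
  {ω | ∃ w, m ≤ w.length ∧ Reaches ω u (u ++ w)}

theorem measurableSet_reachesDepth {d k : ℕ} (hk : 1 ≤ k) (m : ℕ) (u : Vertex d) :
    MeasurableSet[edgeSigma {e : Edge d k | u <+: e.source}] (reachesDepth d k m u) := by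
  have : reachesDepth d k m u = ⋃ w : Vertex d, ⋃ _ : m ≤ w.length, {ω | Reaches ω u (u ++ w)} := by
    ext ω
    simp [reachesDepth]
  rw [this]
  exact MeasurableSet.iUnion fun w => MeasurableSet.iUnion fun _ =>
    measurableSet_reaches hk u (u ++ w) fun e he _ => he

theorem law_reachesDepth {d k : ℕ} (hk : 1 ≤ k) (p q : I) (m : ℕ) (u : Vertex d) :
    (law d k p q).real (reachesDepth d k m u) = (law d k p q).real (reachesDepth d k m []) := by
  have hm : MeasurableSet (reachesDepth d k m []) :=
    edgeSigma_le _ _ (measurableSet_reachesDepth hk m [])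
  rw [measureReal_def, measureReal_def,
    ← (measurePreserving_shift p q u).measure_preimage hm.nullMeasurableSet]
  congr 2
  ext ω
  simp [reachesDepth, reaches_shift]

theorem reachesDepth_antitone (d k : ℕ) (u : Vertex d) :
    Antitone fun m => reachesDepth d k m u :=
  fun _ _ h _ ⟨w, hw, hr⟩ => ⟨w, h.trans hw, hr⟩

theorem reaches_inter_reachesDepth_subset {d k : ℕ} (m : ℕ) (v : Vertex d) :
    {ω | Reaches ω [] v} ∩ reachesDepth d k m v ⊆ reachesDepth d k (m + v.length) [] := by
  rintro ω ⟨h1, w, hw, h2⟩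
  exact ⟨v ++ w, by rw [List.length_append]; omega, Relation.ReflTransGen.trans h1 h2⟩

/-- Edges arriving no deeper than `v` and edges leaving `v` or its descendants are disjoint
families, so the two events are independent even though long edges may jump over `v`. -/
theorem law_reaches_inter_reachesDepth {d k : ℕ} (hd : 1 ≤ d) (hk : 1 ≤ k) (p q : I) (m : ℕ)
    (v : Vertex d) : (law d k p q).real ({ω | Reaches ω [] v} ∩ reachesDepth d k m v) =
      rayProb k p q v.length * (law d k p q).real (reachesDepth d k m []) := by
  have hdisj : Disjoint {e : Edge d k | e.target.length ≤ v.length}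
      {e : Edge d k | v <+: e.source} := by
    refine Set.disjoint_left.2 fun e h1 h2 => ?_
    have h3 := length_source_lt hk e
    have h4 := List.IsPrefix.length_le h2
    have h5 : e.target.length ≤ v.length := h1
    omega
  rw [← law_reachesDepth hk p q m v, measureReal_def, law_inter p q hdisj
    (measurableSet_reaches hk [] v fun e _ he => he.length_le) (measurableSet_reachesDepth hk m v),
    ENNReal.toReal_mul, law_reaches hd hk, ENNReal.toReal_ofReal (rayProb_nonneg k p.2 q.2 _)]
  rfl

theorem law_reachesDepth_inter {d k : ℕ} (hk : 1 ≤ k) (p q : I) (m : ℕ) {v w : Vertex d}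
    (hlen : v.length = w.length) (hvw : v ≠ w) :
    (law d k p q).real (reachesDepth d k m v ∩ reachesDepth d k m w) =
      (law d k p q).real (reachesDepth d k m []) ^ 2 := by
  have hdisj : Disjoint {e : Edge d k | v <+: e.source} {e : Edge d k | w <+: e.source} :=
    Set.disjoint_left.2 fun e h1 h2 =>
      hvw ((List.prefix_of_prefix_length_le h1 h2 hlen.le).eq_of_length hlen)
  rw [measureReal_def, law_inter p q hdisj (measurableSet_reachesDepth hk m v)
    (measurableSet_reachesDepth hk m w), ENNReal.toReal_mul, ← measureReal_def, ← measureReal_def,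
    law_reachesDepth hk p q m v, law_reachesDepth hk p q m w, sq]

/-- A Bonferroni inequality. -/
theorem sum_measureReal_le_measureReal_biUnion_add {Ω ι : Type*} [MeasurableSpace Ω]
    (μ : Measure Ω) [IsFiniteMeasure μ] {G : ι → Set Ω} (hG : ∀ i, MeasurableSet (G i)) {c : ℝ}
    (hc : ∀ i j, i ≠ j → μ.real (G i ∩ G j) ≤ c) (hc0 : 0 ≤ c) (s : Finset ι) :
    ∑ i ∈ s, μ.real (G i) ≤ μ.real (⋃ i ∈ s, G i) + (s.card : ℝ) ^ 2 * c := by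
  classical
  induction s using Finset.induction_on with
  | empty => simp
  | insert a s ha ih =>
    have h1 : μ.real (G a ∪ ⋃ i ∈ s, G i) + μ.real (G a ∩ ⋃ i ∈ s, G i) =
        μ.real (G a) + μ.real (⋃ i ∈ s, G i) :=
      measureReal_union_add_inter (s.measurableSet_biUnion fun i _ => hG i)
        (measure_ne_top _ _) (measure_ne_top _ _)
    have h2 : μ.real (G a ∩ ⋃ i ∈ s, G i) ≤ s.card * c := by
      rw [Set.inter_iUnion₂]
      calc _ ≤ ∑ i ∈ s, μ.real (G a ∩ G i) := measureReal_biUnion_finset_le s _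
        _ ≤ ∑ i ∈ s, c := Finset.sum_le_sum fun i hi => hc a i fun h => ha (h ▸ hi)
        _ = s.card * c := by rw [Finset.sum_const, nsmul_eq_mul]
    rw [Finset.sum_insert ha, Finset.set_biUnion_insert, Finset.card_insert_of_notMem ha]
    push_cast
    have h3 : 0 ≤ (s.card : ℝ) * c := by positivity
    nlinarith

/-- Let θ be the probability of reaching depth m, D = d^n, and a the crossing probability of a ray
of length n. The Bonferroni inequality over the D vertices at depth n gives Daθ ≤ θ + D²θ². As θ >
0, this yields θ ≥ (Da − 1)/D², uniformly in m. -/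
theorem law_reachesInfinity_pos {d k : ℕ} (hd : 1 ≤ d) (hk : 1 ≤ k) {p q : I} {n : ℕ}
    (hn : 1 < (d : ℝ) ^ n * rayProb k p q n) :
    0 < law d k p q (reachesInfinity d k []) := by
  set μ := law d k p q with hμ
  set θ : ℕ → ℝ := fun m => μ.real (reachesDepth d k m []) with hθ
  set D : ℝ := (d : ℝ) ^ n with hD
  have hD0 : 0 < D := by positivity
  have ha : 0 < rayProb k p q n := by
    by_contra! h
    have := mul_nonpos_of_nonneg_of_nonpos hD0.le h
    linarith
  have hn0 : n ≠ 0 := by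
    rintro rfl
    simp [hD, rayProb, rayReached_nil] at hn
  have hmeas (v : Vertex d) (m : ℕ) :
      MeasurableSet ({ω | Reaches ω [] v} ∩ reachesDepth d k m v) :=
    (edgeSigma_le Set.univ _ (measurableSet_reaches hk [] v fun _ _ _ => trivial)).inter
      (edgeSigma_le _ _ (measurableSet_reachesDepth hk m v))
  have hanti : Antitone θ := fun i j h => measureReal_mono (reachesDepth_antitone d k [] h)
  -- Positivity at every depth is needed to divide the quadratic inequality by `θ m`.
  have hstep (m : ℕ) (hm : 0 < θ m) : 0 < θ (m + n) := by
    set v : Vertex d := List.replicate n ⟨0, hd⟩ with hv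
    have hlen : v.length = n := List.length_replicate
    have h1 := law_reaches_inter_reachesDepth hd hk p q m v
    have h2 := measureReal_mono (μ := μ) (reaches_inter_reachesDepth_subset (k := k) m v)
    rw [h1, hlen] at h2
    exact (mul_pos ha hm).trans_le h2
  have hpos (m : ℕ) : 0 < θ m := by
    have h (j : ℕ) : 0 < θ (n * j) := by
      induction j with
      | zero =>
        have : reachesDepth d k 0 [] = Set.univ :=
          Set.eq_univ_of_forall fun ω => ⟨[], le_rfl, Relation.ReflTransGen.refl⟩
        simp [hθ, this]
      | succ j ih => exact hstep _ ih
    exact (h m).trans_le (hanti (Nat.le_mul_of_pos_left m (Nat.pos_of_ne_zero hn0)))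
  have hlow (m : ℕ) : (D * rayProb k p q n - 1) / D ^ 2 ≤ θ m := by
    set G : (Fin n → Fin d) → Set (Config d k) := fun v =>
      {ω | Reaches ω [] (List.ofFn v)} ∩ reachesDepth d k m (List.ofFn v) with hG
    have h1 := sum_measureReal_le_measureReal_biUnion_add μ (G := G) (c := θ m ^ 2)
      (fun v => hmeas _ m) (fun v w hvw => ?_) (by positivity) Finset.univ
    · have h2 : μ.real (⋃ v ∈ Finset.univ, G v) ≤ θ m := by
        refine measureReal_mono (Set.iUnion₂_subset fun v _ => ?_)
        exact (reaches_inter_reachesDepth_subset m _).trans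
          (reachesDepth_antitone d k [] (Nat.le_add_right _ _))
      have h3 : ∑ v, μ.real (G v) = D * (rayProb k p q n * θ m) := by
        simp only [hG, hμ, law_reaches_inter_reachesDepth hd hk, List.length_ofFn,
          Finset.sum_const, Finset.card_univ, Fintype.card_fun, Fintype.card_fin, nsmul_eq_mul,
          hD, hθ]
        push_cast
        rfl
      have h4 : ((Finset.univ : Finset (Fin n → Fin d)).card : ℝ) = D := by
        simp [hD]
      rw [h3, h4] at h1
      rw [div_le_iff₀ (by positivity)]
      have h5 : θ m * (D * rayProb k p q n - 1) ≤ θ m * (θ m * D ^ 2) := by linarith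
      exact le_of_mul_le_mul_left h5 (hpos m)
    · have h2 := law_reachesDepth_inter hk p q m (v := List.ofFn v) (w := List.ofFn w) (by simp)
        (fun h => hvw (List.ofFn_injective h))
      refine le_trans (measureReal_mono ?_) h2.le
      exact Set.inter_subset_inter Set.inter_subset_right Set.inter_subset_right
  have hlim : Filter.Tendsto (fun m => μ (reachesDepth d k m [])) Filter.atTop
      (nhds (μ (⋂ m, reachesDepth d k m []))) :=
    tendsto_measure_iInter_atTop
      (fun m => (edgeSigma_le _ _ (measurableSet_reachesDepth hk m [])).nullMeasurableSet)
      (reachesDepth_antitone d k []) ⟨0, measure_ne_top _ _⟩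
  have hge : ENNReal.ofReal ((D * rayProb k p q n - 1) / D ^ 2) ≤
      μ (⋂ m, reachesDepth d k m []) :=
    ge_of_tendsto' hlim fun m => ENNReal.ofReal_le_of_le_toReal (hlow m)
  refine (ENNReal.ofReal_pos.2 (div_pos (by linarith) (by positivity))).trans_le
    (hge.trans (measure_mono fun ω hω hfin => ?_))
  obtain ⟨N, hN⟩ := (hfin.image List.length).bddAbove
  obtain ⟨w, hw, hr⟩ := Set.mem_iInter.1 hω (N + 1)
  have := hN ⟨w, hr, rfl⟩
  omega

/-! ### Consequences for the critical value -/

theorem mem_percolativeRegion_of_lt {d k : ℕ} (hd : 1 ≤ d) (hk : 1 ≤ k) {p q : I} {n : ℕ}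
    (hn : 1 < (d : ℝ) ^ n * rayProb k p q n) : (p, q) ∈ percolativeRegion d k :=
  law_reachesInfinity_pos hd hk hn

theorem qc_le {d k : ℕ} {p q : I} (h : (p, q) ∈ percolativeRegion d k) : qc d p k ≤ q :=
  csInf_le ⟨0, by rintro _ ⟨x, -, rfl⟩; exact x.2.1⟩ ⟨q, h, rfl⟩

/-- If pd ≥ 1, short edges alone are at least critical, and any positive density of long edges
already makes rays of length `k` strictly supercritical. -/
theorem mul_lt_one_of_qc_pos {d k : ℕ} (hd : 2 ≤ d) (hk : 1 ≤ k) {p : I} (hpos : 0 < qc d p k) :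
    (p : ℝ) * d < 1 := by
  by_contra! hpd
  obtain ⟨x, hx0, hx⟩ := exists_between (lt_min hpos one_pos)
  have hx1 : x ∈ Set.Icc (0 : ℝ) 1 := ⟨hx0.le, (hx.trans_le (min_le_right _ _)).le⟩
  refine absurd (qc_le (q := ⟨x, hx1⟩) (mem_percolativeRegion_of_lt (by omega) hk (n := k) ?_))
    (not_le.2 (hx.trans_le (min_le_left _ _)))
  have h1 := le_rayProb_self hk p.2 hx1
  have hdk : 0 < (d : ℝ) ^ k := by positivity
  have hd2 : (2 : ℝ) ≤ d := by exact_mod_cast hd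
  have hpk : (1 : ℝ) ≤ d ^ k * (p : ℝ) ^ k := by
    rw [← mul_pow, mul_comm]
    exact one_le_pow₀ hpd
  refine lt_of_lt_of_le ?_ (mul_le_mul_of_nonneg_left h1 hdk.le)
  have hpk1 : (p : ℝ) ^ k ≤ 1 := pow_le_one₀ p.2.1 p.2.2
  rcases hpk1.eq_or_lt with h | h
  · have : (1 : ℝ) < d ^ k := one_lt_pow₀ (by linarith) (by omega)
    rw [h]
    linarith
  · have : 0 < (d : ℝ) ^ k * (x * (1 - (p : ℝ) ^ k)) :=
      mul_pos hdk (mul_pos hx0 (by linarith))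
    linarith

end TreePercolation

theorem theorem1 (d : ℕ) (hd : 2 ≤ d) (k : ℕ) (hk : 1 ≤ k) (p : unitInterval)
    (hpos : 0 < TreePercolation.qc d p k) :
    TreePercolation.qc d p (k + 1) < TreePercolation.qc d p k := by
  open TreePercolation in
  have hd1 : 1 ≤ d := by omega
  have hpd := mul_lt_one_of_qc_pos hd hk hpos
  have hne : ((fun q : unitInterval => (q : ℝ)) ''
      {q | (p, q) ∈ percolativeRegion d k}).Nonempty := by
    -- The real infimum of the empty set is 0, which `hpos` excludes.
    by_contra h
    rw [qc, Set.not_nonempty_iff_eq_empty.1 h, Real.sInf_empty] at hpos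
    exact hpos.false
  set x := qc d p k with hx
  have hx1 : x ≤ 1 := by
    obtain ⟨_, q, hq, rfl⟩ := hne
    exact (qc_le hq).trans q.2.2
  have hxI : x ∈ Set.Icc (0 : ℝ) 1 := ⟨hpos.le, hx1⟩
  by_cases hsup : ∃ n, 1 < (d : ℝ) ^ n * rayProb (k + 1) p x n
  · obtain ⟨n, hn⟩ := hsup
    -- Lowering the parameter from `x` to `y` loses at most the factor `(y / x) ^ n`, so the strict
    -- inequality survives for `y` close to `x`.
    have hcont : Filter.Tendsto (fun y : ℝ => (y / x) ^ n * ((d : ℝ) ^ n * rayProb (k + 1) p x n))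
        (nhdsWithin x (Set.Iio x)) (nhds ((x / x) ^ n * ((d : ℝ) ^ n * rayProb (k + 1) p x n))) :=
      Filter.Tendsto.mono_left (Continuous.tendsto (by fun_prop) x) nhdsWithin_le_nhds
    rw [div_self hpos.ne', one_pow, one_mul] at hcont
    obtain ⟨y, hy, hy0, hyx⟩ := ((hcont.eventually (lt_mem_nhds hn)).and
      (Ioo_mem_nhdsLT hpos)).exists
    refine lt_of_le_of_lt (qc_le (q := ⟨y, hy0.le, hyx.le.trans hx1⟩)
      (mem_percolativeRegion_of_lt hd1 (by omega) (n := n) (hy.trans_le ?_))) hyx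
    have h1 := rayProb_le_pow_mul (k + 1) p.2 hy0 hyx.le hx1 n
    have h2 : (y / x) ^ n * (x / y) ^ n = 1 := by
      rw [← mul_pow, div_mul_div_cancel₀ hpos.ne', div_self hy0.ne', one_pow]
    have h3 : 0 ≤ (y / x) ^ n := by positivity
    calc (y / x) ^ n * ((d : ℝ) ^ n * rayProb (k + 1) p x n)
        = (d : ℝ) ^ n * ((y / x) ^ n * rayProb (k + 1) p x n) := by ring
      _ ≤ (d : ℝ) ^ n * ((y / x) ^ n * ((x / y) ^ n * rayProb (k + 1) p y n)) := by gcongr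
      _ = (d : ℝ) ^ n * rayProb (k + 1) p y n := by rw [← mul_assoc ((y / x) ^ n), h2, one_mul]
  · push Not at hsup
    obtain ⟨ρ, hρ, hsum⟩ := exists_summable_of_rayProb_succ_le hk p.2 hxI hpos
      (by exact_mod_cast hd : (1 : ℝ) < d) hpd hsup
    -- Since `x` is the infimum, some percolating `q` lies below `ρ * x`; the summability at `x`
    -- with the extra factor `ρ ^ n` contradicts it.
    obtain ⟨_, ⟨q, hq, rfl⟩, hqlt⟩ := exists_lt_of_csInf_lt hne
      (show sInf _ < ρ * x from (lt_mul_iff_one_lt_left hpos).2 hρ)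
    have hxq : x ≤ q := qc_le hq
    refine absurd (law_reachesInfinity_eq_zero hd1 hk (q := q) ?_) (ne_of_gt hq)
    refine Summable.of_nonneg_of_le
      (fun n => mul_nonneg (by positivity) (rayProb_nonneg k p.2 q.2 n)) (fun n => ?_) hsum
    have h1 := rayProb_nonneg k p.2 hxI n
    have h2 : (q : ℝ) / x ≤ ρ := (div_le_iff₀ hpos).2 hqlt.le
    calc (d : ℝ) ^ n * rayProb k p q n
        ≤ (d : ℝ) ^ n * ((q / x) ^ n * rayProb k p x n) := by
          gcongr
          exact rayProb_le_pow_mul k p.2 hpos hxq q.2.2 n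
      _ ≤ (d : ℝ) ^ n * (ρ ^ n * rayProb k p x n) := by
          have : 0 ≤ (q : ℝ) / x := div_nonneg q.2.1 hpos.le
          gcongr
      _ = (d * ρ) ^ n * rayProb k p x n := by rw [mul_pow, mul_assoc]
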